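/- Let $\Sigma$ be a finite alphabet and $k\ge 1$; both are known to the two parties. In the $\mathrm{LCP}^k$ problem Alice holds a string $A$ over $\Sigma$, Bob holds strings $B_1,\dots,B_k$ over $\Sigma$ (of arbitrary finite lengths), and they have to determine $\ell=\max_i \mathrm{LCP}(A,B_i)$, where $\mathrm{LCP}(A,B_i)$ is the length of the longest common prefix of $A$ and $B_i$. Let $z$ be the number of phrases in the self-referential LZ77 parse of the prefix $A[1..\ell]$: the greedy left-to-right partition in which the phrase starting at position $u$ consists of the longest substring starting at $u$ that also has an occurrence starting to the left of $u$ (possibly overlapping the phrase), followed by one further symbol; for the last phrase, the copied part is chosen as long as possible subject to a symbol being left to follow it. Write $\lg x=\max(1,\log_2 x)$ inside the bounds. For every constant error $0<\epsilon<1/2$ the $\mathrm{LCP}^k$ problem has a randomized public-coin protocol using 1. $O(\lg z+\lg\lg \ell)$ rounds and $O(\lg z\lg k+\lg \ell)$ bits of communication, and also a randomized public-coin protocol using 2. $O(\lg z)$ rounds and $O(\lg z\lg k+\lg \ell+\lg\lg\lg|A|)$ bits of communication. The constants in the $O$'s depend only on $\epsilon$. Here the parties share an infinite sequence of independent unbiased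 coin tosses and are otherwise deterministic, each protocol terminates for all inputs and all coin tosses, and for every input $(A;B_1,\dots,B_k)$, with probability at least $1-\epsilon$ over the coin tosses, the protocol outputs $\ell$ within the stated numbers of rounds and bits. -/

import Mathlib

open MeasureTheory

noncomputable section

/-! ### Strings, longest common prefixes -/

namespace LZComm

variable {α : Type*}

open Classical in
/-- The length of the longest common prefix of two strings: the largest `m` not exceeding
either length such that the prefixes of length `m` agree. -/
def lcp (A B : List α) : ℕ :=
  Nat.findGreatest (fun m => A.take m = B.take m) (min A.length B.length)

/-- The largest length of a common prefix of `A` and any one of the strings `B i`. -/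
def lcpMax {k : ℕ} (A : List α) (B : Fin k → List α) : ℕ :=
  Finset.univ.sup fun i => lcp A (B i)

/-! ### The self-referential LZ77 parse -/

/-- A phrase of an LZ77 parse: the (1-based) position of an earlier occurrence of the copied
part, the length of the copied part, and the symbol that follows it. If the copied part is
empty, the position is `0`. -/
structure Phrase (α : Type*) where
  source : ℕ
  length : ℕ
  symbol : α

/-- The `l` symbols of `S` from (0-based) position `u` on also occur from position `s` on, where
`s < u`. The two occurrences may overlap: this is the self-referential version. -/
def OccursAt (S : List α) (u l s : ℕ) : Prop :=
  s < u ∧ (S.drop s).take l = (S.drop u).take l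

open Classical in
/-- The length of the longest substring starting at (0-based) position `u` that has an
occurrence starting to the left of `u` and is followed by a further symbol of `S`. -/
def copyLength (S : List α) (u : ℕ) : ℕ :=
  Nat.findGreatest (fun l => ∃ s, OccursAt S u l s) (S.length - u - 1)

open Classical in
/-- The 1-based position of the leftmost earlier occurrence of the copied part, and `0` if
the copied part is empty. -/
def copySource (S : List α) (u : ℕ) : ℕ :=
  if copyLength S u = 0 then 0 else sInf {s | OccursAt S u (copyLength S u) s} + 1

open Classical in
theorem add_copyLength_lt (S : List α) {u : ℕ} (h : u < S.length) :
    u + copyLength S u < S.length := by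
  have : copyLength S u ≤ S.length - u - 1 := by
    unfold copyLength
    exact Nat.findGreatest_le _
  omega

/-- The greedy parse of the part of `S` that starts at (0-based) position `u`. -/
def parseFrom (S : List α) (u : ℕ) : List (Phrase α) :=
  if h : u < S.length then
    { source := copySource S u
      length := copyLength S u
      symbol := S[u + copyLength S u]'(add_copyLength_lt S h) } ::
      parseFrom S (u + copyLength S u + 1)
  else []
termination_by S.length - u

/-- The self-referential LZ77 parse of `S`. -/
def lz77 (S : List α) : List (Phrase α) := parseFrom S 0

/-- The number of phrases in the self-referential LZ77 parse of `S`. -/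
def numPhrases (S : List α) : ℕ := (lz77 S).length

/-! ### Two-party communication protocols -/

/-- The two parties. -/
inductive Party where
  | alice
  | bob

/-- The label of a node of a protocol tree: an inner node belongs to the party that sends the
next bit, a leaf carries the output. -/
inductive Node (Z : Type*) where
  | speak (p : Party)
  | halt (z : Z)

/-- A deterministic two-party protocol, as a binary tree of possibly unbounded depth. The nodes
are the transcripts (the bits sent so far, by either party). Whose turn it is, whether the
protocol has ended, and the output depend on the transcript only; a bit sent by a party depends
on the input of that party and on the transcript. -/
structure Protocol (X Y Z : Type*) where
  node : List Bool → Node Z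
  aliceBit : X → List Bool → Bool
  bobBit : Y → List Bool → Bool

/-- A configuration in the execution of a protocol: the bits sent so far, the sender of the last
bit, and the number of rounds so far. A round is a maximal sequence of consecutive bits sent by
the same party. -/
structure Config where
  transcript : List Bool
  last : Option Party
  rounds : ℕ

open Classical in
/-- Party `p` sends the bit `b`. -/
def Config.send (c : Config) (p : Party) (b : Bool) : Config where
  transcript := c.transcript ++ [b]
  last := some p
  rounds := if c.last = some p then c.rounds else c.rounds + 1

namespace Protocol

variable {X Y Z : Type*}

/-- One step of the execution on inputs `x` and `y`. -/
def step (P : Protocol X Y Z) (x : X) (y : Y) (c : Config) : Config :=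
  match P.node c.transcript with
  | .speak .alice => c.send .alice (P.aliceBit x c.transcript)
  | .speak .bob => c.send .bob (P.bobBit y c.transcript)
  | .halt _ => c

/-- The configuration after `t` steps on inputs `x` and `y`. -/
def run (P : Protocol X Y Z) (x : X) (y : Y) : ℕ → Config
  | 0 => ⟨[], none, 0⟩
  | t + 1 => P.step x y (P.run x y t)

/-- The execution on inputs `x` and `y` ends. -/
def Halts (P : Protocol X Y Z) (x : X) (y : Y) : Prop :=
  ∃ (t : ℕ) (z : Z), P.node (P.run x y t).transcript = .halt z

/-- The execution on inputs `x` and `y` ends with output `z` after at most `r` rounds, in which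
at most `b` bits are sent in total. -/
def Computes (P : Protocol X Y Z) (x : X) (y : Y) (z : Z) (r b : ℝ) : Prop :=
  ∃ t : ℕ, P.node (P.run x y t).transcript = .halt z ∧
    ((P.run x y t).rounds : ℝ) ≤ r ∧ ((P.run x y t).transcript.length : ℝ) ≤ b

end Protocol

/-- The law of an infinite sequence of independent unbiased coin tosses. -/
def coinMeasure : Measure (ℕ → Bool) :=
  Measure.infinitePi fun _ => (PMF.uniformOfFintype Bool).toMeasure

/-- A randomized public-coin protocol: both parties see the same infinite sequence of coin tosses
and are otherwise deterministic. -/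
structure PublicCoinProtocol (X Y Z : Type*) where
  det : (ℕ → Bool) → Protocol X Y Z
  measurableSet_node : ∀ (τ : List Bool) (n : Node Z), MeasurableSet {ω | (det ω).node τ = n}
  measurableSet_aliceBit : ∀ (x : X) (τ : List Bool),
    MeasurableSet {ω | (det ω).aliceBit x τ = true}
  measurableSet_bobBit : ∀ (y : Y) (τ : List Bool),
    MeasurableSet {ω | (det ω).bobBit y τ = true}

/-- The public-coin protocol `P` always ends, and on every pair of inputs `(x, y)`, with
probability at least `1 - ε` over the coin tosses, it outputs `f x y` after at most
`rounds x y` rounds and `bits x y` bits of communication. -/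
def PublicCoinProtocol.Solves {X Y Z : Type*} (P : PublicCoinProtocol X Y Z) (ε : ℝ)
    (f : X → Y → Z) (rounds bits : X → Y → ℝ) : Prop :=
  (∀ ω x y, (P.det ω).Halts x y) ∧
  ∀ x y, 1 - ε ≤ coinMeasure.real {ω | (P.det ω).Computes x y (f x y) (rounds x y) (bits x y)}

/-- The binary logarithm in asymptotic bounds, taken to be at least `1`. -/
def lg (x : ℝ) : ℝ := max 1 (Real.logb 2 x)

end LZComm

end

noncomputable section

namespace LZComm

section

variable {α : Type*}

/-! ### Longest common prefixes and phrase boundaries -/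

/-! Parse `A` greedily with every copied part as long as possible, and let `boundary A j` be the end
of the `j`-th phrase. A phrase is determined by the text up to and including its last symbol
(`boundary_congr`), so `A` shares its first `j` phrases with some `B i` exactly if `boundary A j ≤
ℓ`. The largest such `j`, called `J` here (`commonPhrases`), is at most `z`. It remains to find `J`
and then the place inside the next phrase where the agreement ends.

Prefixes are compared by hashes of `k.size + c₀` bits. Equal prefixes always pass, and a union bound
over the `k` strings makes a false positive unlikely, with a small constant probability. Galloping
over powers of two gives `T = J.size` with `J < 2 ^ T`, and a binary search follows. Its tests are
not made reliable enough for a union bound over all of them; instead every step tests the current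
lower bound again and backtracks if that fails (`Potential.searchNext`). Each step uses fresh coins,
and by Markov's inequality at most a quarter of the `2 * T` steps go wrong, up to a small
probability; the search tolerates this many (`lowQuery_search`). This takes `O(lg z)` rounds and
`O(lg z lg k)` bits.

Now let `p` be the end of phrase `J`. Alice sends `p`, a source `s` of her next phrase and a hash of
her prefix, in `O(lg k + lg ℓ)` bits. A string of Bob's that agrees with `A` up to `p` keeps
agreeing as long as both continue the copy from `s` (`lcp_eq_add_min`), whence `ℓ = p + min L M` for
Alice's copy length `L` and Bob's best one `M` (`add_min_bobLength`). Since one of `L`, `M` may be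
far larger than `ℓ`, the parties first fix `t` with `min L M < 2 ^ 2 ^ t`: either by trying `t = 0,
1, 2, …`, in `O(lg lg ℓ)` rounds, or by Alice announcing the level of `L`, in `O(lg lg lg |A|)`
bits. The truncated lengths then fit into `O(lg ℓ)` bits. These two choices are the two protocols.
-/

theorem take_eq_take_iff_getElem? (A B : List α) (n : ℕ) :
    A.take n = B.take n ↔ ∀ i < n, A[i]? = B[i]? := by
  constructor
  · intro h i hi
    have := congrArg (fun l => l[i]?) h
    simpa [hi] using this
  · intro h
    apply List.ext_getElem?
    intro i
    by_cases hi : i < n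
    · simpa [hi] using h i hi
    · simp [hi]

/-- No bound on the length of `B` is needed: below the length of `A` the lookup in `A` is not
`none`, so the equalities force `B` to be long enough. -/
theorem le_lcp_iff {A B : List α} {n : ℕ} :
    n ≤ lcp A B ↔ n ≤ A.length ∧ ∀ i < n, A[i]? = B[i]? := by
  classical
  have key : n ≤ lcp A B ↔ n ≤ min A.length B.length ∧ A.take n = B.take n := by
    unfold lcp
    constructor
    · intro h
      refine ⟨h.trans (Nat.findGreatest_le _), ?_⟩
      have h0 : A.take (lcp A B) = B.take (lcp A B) := by
        unfold lcp
        exact Nat.findGreatest_spec (P := fun m => A.take m = B.take m) (Nat.zero_le _) (by simp)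
      rw [take_eq_take_iff_getElem?] at h0 ⊢
      exact fun i hi => h0 i (lt_of_lt_of_le hi h)
    · rintro ⟨h1, h2⟩
      exact Nat.le_findGreatest h1 h2
  rw [key, take_eq_take_iff_getElem?]
  constructor
  · rintro ⟨h1, h2⟩
    exact ⟨h1.trans (min_le_left _ _), h2⟩
  · rintro ⟨h1, h2⟩
    refine ⟨le_min h1 ?_, h2⟩
    by_contra hlt
    push Not at hlt
    have h3 := h2 _ hlt
    rw [List.getElem?_eq_none le_rfl, List.getElem?_eq_none_iff] at h3
    omega

theorem lcp_le_left (A B : List α) : lcp A B ≤ A.length := (le_lcp_iff.1 le_rfl).1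

theorem lcp_comm (A B : List α) : lcp A B = lcp B A := by
  unfold lcp
  rw [min_comm]
  congr 1
  ext m
  exact eq_comm

theorem lcp_le_right (A B : List α) : lcp A B ≤ B.length := by
  rw [lcp_comm]
  exact lcp_le_left B A

theorem getElem?_eq_of_lt_lcp {A B : List α} {i : ℕ} (h : i < lcp A B) : A[i]? = B[i]? :=
  (le_lcp_iff.1 le_rfl).2 i h

theorem le_lcp_drop {S : List α} {s u n : ℕ} (hs : s ≤ u) (hn : u + n ≤ S.length) :
    n ≤ lcp (S.drop s) (S.drop u) ↔ ∀ i < n, S[s + i]? = S[u + i]? := by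
  rw [le_lcp_iff]
  simp only [List.getElem?_drop, List.length_drop]
  constructor
  · exact fun h => h.2
  · exact fun h => ⟨by omega, h⟩

/-- The length of the longest string at position `u` that also occurs further left. -/
def matchLength (S : List α) (u : ℕ) : ℕ :=
  (Finset.range u).sup fun s => lcp (S.drop s) (S.drop u)

theorem add_matchLength_le {S : List α} {u : ℕ} (hu : u ≤ S.length) :
    u + matchLength S u ≤ S.length := by
  have : matchLength S u ≤ S.length - u := by
    refine Finset.sup_le fun s _ => ?_
    simpa using lcp_le_right (S.drop s) (S.drop u)
  omega

theorem exists_lcp_drop_eq_matchLength (S : List α) {u : ℕ} (hu : 0 < u) :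
    ∃ s < u, lcp (S.drop s) (S.drop u) = matchLength S u := by
  obtain ⟨s, hs, h⟩ := Finset.exists_mem_eq_sup (Finset.range u) ⟨0, by simpa using hu⟩
    (fun s => lcp (S.drop s) (S.drop u))
  exact ⟨s, by simpa using hs, h.symm⟩

theorem lcp_drop_le_matchLength (S : List α) {s u : ℕ} (h : s < u) :
    lcp (S.drop s) (S.drop u) ≤ matchLength S u :=
  Finset.le_sup (f := fun s => lcp (S.drop s) (S.drop u)) (Finset.mem_range.2 h)

theorem le_lcp_drop_congr {S S' : List α} {s u m : ℕ} (hs : s ≤ u) (h : u + m ≤ lcp S S') :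
    m ≤ lcp (S.drop s) (S.drop u) ↔ m ≤ lcp (S'.drop s) (S'.drop u) := by
  have h1 := lcp_le_left S S'
  have h2 := lcp_le_right S S'
  rw [le_lcp_drop hs (by omega), le_lcp_drop hs (by omega)]
  refine forall₂_congr fun i hi => ?_
  rw [getElem?_eq_of_lt_lcp (A := S) (B := S') (by omega),
    getElem?_eq_of_lt_lcp (A := S) (B := S') (i := u + i) (by omega)]

theorem le_matchLength_congr {S S' : List α} {u m : ℕ} (h : u + m ≤ lcp S S') :
    m ≤ matchLength S u ↔ m ≤ matchLength S' u := by
  rcases Nat.eq_zero_or_pos m with rfl | hm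
  · simp
  · unfold matchLength
    rw [Finset.le_sup_iff hm, Finset.le_sup_iff hm]
    refine exists_congr fun s => and_congr_right fun hs => ?_
    exact le_lcp_drop_congr (Finset.mem_range.1 hs).le h

/-- The `+ 1` matters: the symbol that breaks the longest match in `S` lies in the common prefix, so
it breaks every match in `S'` as well. -/
theorem matchLength_congr {S S' : List α} {u : ℕ} (h : u + matchLength S u + 1 ≤ lcp S S') :
    matchLength S' u = matchLength S u := by
  apply le_antisymm
  · by_contra hlt
    have := (le_matchLength_congr (m := matchLength S u + 1) (by omega)).2 (by omega : _ ≤ matchLength S' u)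
    omega
  · exact (le_matchLength_congr (by omega)).1 le_rfl

/-- The position behind the `j`-th phrase of the greedy parse of `S` in which each copied part is
as long as possible; it exceeds the length of `S` if there is no such complete phrase. -/
def boundary (S : List α) : ℕ → ℕ
  | 0 => 0
  | j + 1 => boundary S j + matchLength S (boundary S j) + 1

theorem boundary_strictMono (S : List α) : StrictMono (boundary S) :=
  strictMono_nat_of_lt_succ fun j => by simp only [boundary]; omega

theorem le_boundary (S : List α) (j : ℕ) : j ≤ boundary S j := (boundary_strictMono S).le_apply

theorem boundary_congr {S S' : List α} : ∀ {j : ℕ}, boundary S j ≤ lcp S S' →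
    boundary S' j = boundary S j
  | 0, _ => rfl
  | j + 1, h => by
    have h1 : boundary S' j = boundary S j :=
      boundary_congr (((boundary_strictMono S) (Nat.lt_succ_self j)).le.trans h)
    have h2 : matchLength S' (boundary S j) = matchLength S (boundary S j) :=
      matchLength_congr h
    simp only [boundary, h1, h2]

/-- The cap in `copyLength`, which reserves a following symbol, can only bind in the last phrase. It
is void if the longest match leaves a symbol anyway. -/
theorem copyLength_eq_matchLength {S : List α} {u : ℕ} (h : u + matchLength S u + 1 ≤ S.length) :
    copyLength S u = matchLength S u := by
  classical
  have mem : ∀ {l s : ℕ}, u + l ≤ S.length → (OccursAt S u l s ↔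
      s < u ∧ l ≤ lcp (S.drop s) (S.drop u)) := by
    intro l s hl
    unfold OccursAt
    apply and_congr_right
    intro hs
    rw [le_lcp_drop hs.le hl, take_eq_take_iff_getElem?]
    simp only [List.getElem?_drop]
  apply le_antisymm
  · rcases Nat.eq_zero_or_pos (copyLength S u) with h0 | h0
    · omega
    · have hle : copyLength S u ≤ S.length - u - 1 := Nat.findGreatest_le _
      obtain ⟨s, hs⟩ : ∃ s, OccursAt S u (copyLength S u) s :=
        Nat.findGreatest_of_ne_zero (P := fun l => ∃ s, OccursAt S u l s) rfl h0.ne'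
      obtain ⟨hs, h2⟩ := (mem (by omega)).1 hs
      exact h2.trans (lcp_drop_le_matchLength S hs)
  · rcases Nat.eq_zero_or_pos u with rfl | hu
    · simp [matchLength]
    · obtain ⟨s, hs, h2⟩ := exists_lcp_drop_eq_matchLength S hu
      exact Nat.le_findGreatest (by omega) ⟨s, (mem (by omega)).2 ⟨hs, h2.ge⟩⟩

theorem le_length_parseFrom {S : List α} (n : ℕ) :
    ∀ j, boundary S (j + n) ≤ S.length → n ≤ (parseFrom S (boundary S j)).length := by
  induction n with
  | zero => simp
  | succ n ih =>
    intro j hj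
    have h1 : boundary S (j + 1) ≤ S.length :=
      ((boundary_strictMono S).monotone (by omega)).trans hj
    have h2 : boundary S j < boundary S (j + 1) := boundary_strictMono S (Nat.lt_succ_self j)
    have h3 : copyLength S (boundary S j) = matchLength S (boundary S j) :=
      copyLength_eq_matchLength h1
    rw [parseFrom, dif_pos (by omega), List.length_cons, h3]
    have := ih (j + 1) (by rw [show j + 1 + n = j + (n + 1) by omega]; exact hj)
    simp only [boundary] at this
    omega

theorem lcp_take_self {A : List α} {n : ℕ} (hn : n ≤ A.length) : n ≤ lcp A (A.take n) := by
  rw [le_lcp_iff]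
  refine ⟨hn, fun i hi => ?_⟩
  simp [hi]

theorem le_numPhrases_take {A : List α} {j n : ℕ} (hn : n ≤ A.length) (h : boundary A j ≤ n) :
    j ≤ numPhrases (A.take n) := by
  have h1 := lcp_take_self hn
  have h2 : boundary (A.take n) j = boundary A j := boundary_congr (h.trans h1)
  have := le_length_parseFrom (S := A.take n) j 0 (by simp [h2]; omega)
  exact this

/-- If `A` and `B` agree up to position `p` but the phrase of `A` that starts there is not a phrase
of `B`, then their common prefix ends where one of them ceases to continue its copy from `s`. -/
theorem lcp_eq_add_min {A B : List α} {p s : ℕ} (hsp : s < p) (hp : p ≤ lcp A B)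
    (hlt : lcp A B ≤ p + lcp (A.drop s) (A.drop p)) :
    lcp A B = p + min (lcp (A.drop s) (A.drop p)) (lcp (B.drop s) (B.drop p)) := by
  set L := lcp (A.drop s) (A.drop p) with hL
  set M := lcp (B.drop s) (B.drop p) with hM
  have hA : ∀ i < L, A[s + i]? = A[p + i]? := fun i hi => by
    simpa using getElem?_eq_of_lt_lcp (A := A.drop s) (B := A.drop p) hi
  have hB : ∀ i < M, B[s + i]? = B[p + i]? := fun i hi => by
    simpa using getElem?_eq_of_lt_lcp (A := B.drop s) (B := B.drop p) hi
  have hpA := hp.trans (lcp_le_left A B)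
  have hpB := hp.trans (lcp_le_right A B)
  have hLA : p + L ≤ A.length := by
    have := lcp_le_right (A.drop s) (A.drop p)
    simp only [List.length_drop] at this
    omega
  have ge : p + min L M ≤ lcp A B := by
    rw [le_lcp_iff]
    refine ⟨by omega, fun i => ?_⟩
    induction i using Nat.strong_induction_on with
    | _ i ih =>
      intro hi
      by_cases hip : i < p
      · exact getElem?_eq_of_lt_lcp (hip.trans_le hp)
      · obtain ⟨d, rfl⟩ : ∃ d, i = p + d := ⟨i - p, by omega⟩
        -- Both strings copy symbol `p + d` from `s + d`, an earlier position. As the copy may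
        -- overlap itself, `s + d` can lie beyond `p`, hence the strong induction.
        rw [← hA d (by omega), ← hB d (by omega)]
        exact ih _ (by omega) (by omega)
  apply le_antisymm _ ge
  rcases le_total L M with h | h
  · rw [min_eq_left h]; exact hlt
  · rw [min_eq_right h]
    rcases h.eq_or_lt with h | h
    · rw [h]; exact hlt
    -- If the agreement went past `p + M` with `M < L`, then `B` would inherit one more symbol of
    -- the copy from `A`, contrary to the choice of `M`.
    by_contra hc
    have h1 : M + 1 ≤ lcp (A.drop s) (A.drop p) := h
    rw [le_lcp_drop_congr (S' := B) hsp.le (by omega)] at h1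
    omega

/-! ### Common prefixes with `k` strings, measured in phrases -/

section Max

variable {k : ℕ} (A : List α) (B : Fin k → List α)

theorem lcp_le_lcpMax (i : Fin k) : lcp A (B i) ≤ lcpMax A B :=
  Finset.le_sup (f := fun i => lcp A (B i)) (Finset.mem_univ i)

theorem exists_lcp_eq_lcpMax (hk : 1 ≤ k) : ∃ i, lcp A (B i) = lcpMax A B := by
  obtain ⟨i, _, h⟩ := Finset.exists_mem_eq_sup Finset.univ
    (⟨⟨0, hk⟩, Finset.mem_univ _⟩ : (Finset.univ : Finset (Fin k)).Nonempty)
    (fun i => lcp A (B i))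
  exact ⟨i, h.symm⟩

theorem lcpMax_le_length : lcpMax A B ≤ A.length := Finset.sup_le fun i _ => lcp_le_left A (B i)

/-- The number of complete phrases of `A` within its longest common prefix with some `B i`. -/
def commonPhrases : ℕ := Nat.findGreatest (fun j => boundary A j ≤ lcpMax A B) (lcpMax A B)

/-- The predicate is monotone in `j`, which is what a binary search needs. The search range in
`commonPhrases` loses nothing because `j ≤ boundary A j`. -/
theorem boundary_le_lcpMax_iff (j : ℕ) : boundary A j ≤ lcpMax A B ↔ j ≤ commonPhrases A B := by
  constructor
  · intro h
    exact Nat.le_findGreatest ((le_boundary A j).trans h) h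
  · intro h
    have : boundary A (commonPhrases A B) ≤ lcpMax A B :=
      Nat.findGreatest_spec (P := fun j => boundary A j ≤ lcpMax A B) (Nat.zero_le _)
        (by simp [boundary])
    exact ((boundary_strictMono A).monotone h).trans this

theorem commonPhrases_le_numPhrases :
    commonPhrases A B ≤ numPhrases (A.take (lcpMax A B)) :=
  le_numPhrases_take (lcpMax_le_length A B) ((boundary_le_lcpMax_iff A B _).2 le_rfl)

/-- `A` and some `B i` have the same first `j` phrases. -/
theorem boundary_le_lcpMax_iff_exists (hk : 1 ≤ k) (j : ℕ) :
    boundary A j ≤ lcpMax A B ↔ boundary A j ≤ A.length ∧ ∃ i, boundary (B i) j ≤ (B i).length ∧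
      (B i).take (boundary (B i) j) = A.take (boundary A j) := by
  constructor
  · intro h
    obtain ⟨i, hi⟩ := exists_lcp_eq_lcpMax A B hk
    rw [← hi] at h
    have hb := boundary_congr h
    refine ⟨h.trans (lcp_le_left _ _), i, hb ▸ h.trans (lcp_le_right _ _), ?_⟩
    rw [hb, take_eq_take_iff_getElem?]
    exact fun a ha => (getElem?_eq_of_lt_lcp (ha.trans_le h)).symm
  · rintro ⟨h1, i, h2, h3⟩
    have hl := congrArg List.length h3
    simp only [List.length_take] at hl
    rw [min_eq_left h2, min_eq_left h1] at hl
    rw [hl, take_eq_take_iff_getElem?] at h3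
    refine le_trans ?_ (lcp_le_lcpMax A B i)
    exact le_lcp_iff.2 ⟨h1, fun a ha => (h3 a ha).symm⟩

end Max

end

section

/-! ### Protocols in which the parties alternately send bit strings -/

/-- A public-coin protocol as a state machine: in every state Alice sends a bit string, Bob replies
with a bit string, and these strings determine the next state. -/
structure Machine (X Y Z : Type*) where
  State : Type
  init : State
  out : State → Option Z
  alice : State → X → (ℕ → Bool) → List Bool
  bob : State → List Bool → Y → (ℕ → Bool) → List Bool
  next : State → List Bool → List Bool → State
  measurableSet_alice : ∀ s x l, MeasurableSet {ω | alice s x ω = l}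
  measurableSet_bob : ∀ s a y l, MeasurableSet {ω | bob s a y ω = l}

namespace Machine

variable {X Y Z : Type*} (M : Machine X Y Z)

/-- The states of the bitwise execution: `p` sends its next continuation bit or, if the last
component is `true`, its next data bit; `a` is the string sent by Alice in the current exchange. -/
inductive BitState (S : Type)
  | alice (s : S) (a : List Bool) (data : Bool)
  | bob (s : S) (a b : List Bool) (data : Bool)

def bitNext : BitState M.State → Bool → BitState M.State
  | .alice s a false, c => if c then .alice s a true else .bob s a [] false
  | .alice s a true, c => .alice s (a ++ [c]) false
  | .bob s a b false, c => if c then .bob s a b true else .alice (M.next s a b) [] false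
  | .bob s a b true, c => .bob s a (b ++ [c]) false

/-- The state is recovered from the public transcript alone, as required for the nodes of a protocol
tree. -/
def bitState (τ : List Bool) : BitState M.State := τ.foldl M.bitNext (.alice M.init [] false)

theorem bitState_append (τ : List Bool) (c : Bool) :
    M.bitState (τ ++ [c]) = M.bitNext (M.bitState τ) c := by
  simp [bitState]

def bitNode : BitState M.State → Node Z
  | .alice s _ _ => match M.out s with
    | some z => .halt z
    | none => .speak .alice
  | .bob _ _ _ _ => .speak .bob

/-- The bit that follows the data string `a` when `l` is to be sent. -/
def nextBit (l a : List Bool) : Bool → Bool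
  | false => decide (a.length < l.length)
  | true => l.getD a.length false

def bitAlice (x : X) (ω : ℕ → Bool) : BitState M.State → Bool
  | .alice s a d => nextBit (M.alice s x ω) a d
  | .bob _ _ _ _ => false

def bitBob (y : Y) (ω : ℕ → Bool) : BitState M.State → Bool
  | .alice _ _ _ => false
  | .bob s a b d => nextBit (M.bob s a y ω) b d

theorem measurableSet_nextBit {f : (ℕ → Bool) → List Bool}
    (hf : ∀ l, MeasurableSet {ω | f ω = l}) (a : List Bool) (d : Bool) :
    MeasurableSet {ω | nextBit (f ω) a d = true} := by
  have : {ω | nextBit (f ω) a d = true} =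
      ⋃ l ∈ {l : List Bool | nextBit l a d = true}, {ω | f ω = l} := by
    ext ω
    simp
  rw [this]
  exact MeasurableSet.biUnion (Set.to_countable _) fun l _ => hf l

/-- The protocol in which the strings are sent in the prefix-free code that puts a continuation bit
`true` before every bit and `false` at the end. -/
def toProtocol : PublicCoinProtocol X Y Z where
  det ω :=
    { node := fun τ => M.bitNode (M.bitState τ)
      aliceBit := fun x τ => M.bitAlice x ω (M.bitState τ)
      bobBit := fun y τ => M.bitBob y ω (M.bitState τ) }
  measurableSet_node τ n := MeasurableSet.const (M.bitNode (M.bitState τ) = n)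
  measurableSet_aliceBit x τ := by
    change MeasurableSet {ω | M.bitAlice x ω (M.bitState τ) = true}
    rcases M.bitState τ with ⟨s, a, d⟩ | ⟨s, a, b, d⟩
    · exact measurableSet_nextBit (M.measurableSet_alice s x) a d
    · simp [bitAlice]
  measurableSet_bobBit y τ := by
    change MeasurableSet {ω | M.bitBob y ω (M.bitState τ) = true}
    rcases M.bitState τ with ⟨s, a, d⟩ | ⟨s, a, b, d⟩
    · simp [bitBob]
    · exact measurableSet_nextBit (M.measurableSet_bob s a y) b d

/-- The state after the exchange in state `s`. -/
def exchange (ω : ℕ → Bool) (x : X) (y : Y) (s : M.State) : M.State :=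
  M.next s (M.alice s x ω) (M.bob s (M.alice s x ω) y ω)

/-- The number of bits that the exchange in state `s` takes. -/
def cost (ω : ℕ → Bool) (x : X) (y : Y) (s : M.State) : ℕ :=
  2 * (M.alice s x ω).length + 1 + (2 * (M.bob s (M.alice s x ω) y ω).length + 1)

/-- `M.Reaches ω x y s n b s'` states that `n` exchanges lead from `s` to `s'` and take at most
`b` bits. -/
inductive Reaches (ω : ℕ → Bool) (x : X) (y : Y) : M.State → ℕ → ℕ → M.State → Prop
  | refl (s : M.State) : Reaches ω x y s 0 0 s
  | step {s s' : M.State} {n b c : ℕ} : M.out s = none → M.cost ω x y s ≤ c →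
      Reaches ω x y (M.exchange ω x y s) n b s' → Reaches ω x y s (n + 1) (c + b) s'

variable {M} {ω : ℕ → Bool} {x : X} {y : Y}

theorem Reaches.trans {s s' s'' : M.State} {n b n' b' : ℕ} (h : M.Reaches ω x y s n b s')
    (h' : M.Reaches ω x y s' n' b' s'') : M.Reaches ω x y s (n + n') (b + b') s'' := by
  induction h with
  | refl => simpa using h'
  | step h1 h2 _ ih =>
    have := Reaches.step h1 h2 (ih h')
    rwa [← add_assoc, add_right_comm] at this

theorem Reaches.single {s : M.State} {c : ℕ} (h1 : M.out s = none) (h2 : M.cost ω x y s ≤ c) :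
    M.Reaches ω x y s 1 c (M.exchange ω x y s) := by
  simpa using Reaches.step h1 h2 (Reaches.refl _)

theorem run_succ_of_alice {t : ℕ} {s : M.State} {a : List Bool} {d : Bool} (hs : M.out s = none)
    (h : M.bitState ((M.toProtocol.det ω).run x y t).transcript = .alice s a d) :
    (M.toProtocol.det ω).run x y (t + 1) =
      ((M.toProtocol.det ω).run x y t).send .alice (nextBit (M.alice s x ω) a d) := by
  have h1 : (M.toProtocol.det ω).node ((M.toProtocol.det ω).run x y t).transcript =
      .speak .alice := by
    change M.bitNode (M.bitState _) = _
    rw [h, bitNode, hs]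
  have h2 : (M.toProtocol.det ω).aliceBit x ((M.toProtocol.det ω).run x y t).transcript =
      nextBit (M.alice s x ω) a d := by
    change M.bitAlice x ω (M.bitState _) = _
    rw [h, bitAlice]
  rw [Protocol.run, Protocol.step, h1, h2]

theorem run_succ_of_bob {t : ℕ} {s : M.State} {a b : List Bool} {d : Bool}
    (h : M.bitState ((M.toProtocol.det ω).run x y t).transcript = .bob s a b d) :
    (M.toProtocol.det ω).run x y (t + 1) =
      ((M.toProtocol.det ω).run x y t).send .bob (nextBit (M.bob s a y ω) b d) := by
  have h1 : (M.toProtocol.det ω).node ((M.toProtocol.det ω).run x y t).transcript =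
      .speak .bob := by
    change M.bitNode (M.bitState _) = _
    rw [h, bitNode]
  have h2 : (M.toProtocol.det ω).bobBit y ((M.toProtocol.det ω).run x y t).transcript =
      nextBit (M.bob s a y ω) b d := by
    change M.bitBob y ω (M.bitState _) = _
    rw [h, bitBob]
  rw [Protocol.run, Protocol.step, h1, h2]

theorem rounds_send_le (c : Config) (p : Party) (b : Bool) : (c.send p b).rounds ≤ c.rounds + 1 := by
  unfold Config.send
  dsimp only
  split <;> omega

theorem rounds_send_of_last {c : Config} {p : Party} (h : c.last = some p) (b : Bool) :
    (c.send p b).rounds = c.rounds := by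
  simp [Config.send, h]

/-- Induction on the part `l` of the message still to be sent. The disjunction on rounds covers the
start of the message, where a new round may open, and its middle, where Alice spoke last and the
round is already counted. -/
theorem exists_run_alice {s : M.State} (hs : M.out s = none) (r : ℕ) (l : List Bool) :
    ∀ (a : List Bool) (t : ℕ), a ++ l = M.alice s x ω →
      M.bitState ((M.toProtocol.det ω).run x y t).transcript = .alice s a false →
      (((M.toProtocol.det ω).run x y t).rounds ≤ r ∨
        ((M.toProtocol.det ω).run x y t).rounds ≤ r + 1 ∧
        ((M.toProtocol.det ω).run x y t).last = some .alice) →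
      M.bitState ((M.toProtocol.det ω).run x y (t + (2 * l.length + 1))).transcript =
        .bob s (M.alice s x ω) [] false ∧
      ((M.toProtocol.det ω).run x y (t + (2 * l.length + 1))).rounds ≤ r + 1 := by
  induction l with
  | nil =>
    intro a t ha h hr
    rw [List.append_nil] at ha
    have h1 := run_succ_of_alice hs h
    simp only [List.length_nil, mul_zero, zero_add]
    rw [h1]
    constructor
    · simp only [Config.send, bitState_append, h, bitNext, nextBit, ha]
      simp
    · rcases hr with hr | ⟨hr, hl⟩
      · exact (rounds_send_le _ _ _).trans (by omega)
      · rw [rounds_send_of_last hl]; exact hr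
  | cons c l ih =>
    intro a t ha h hr
    have h1 := run_succ_of_alice hs h
    have h2 : M.bitState ((M.toProtocol.det ω).run x y (t + 1)).transcript = .alice s a true := by
      rw [h1]
      simp only [Config.send, bitState_append, h, bitNext, nextBit, ← ha]
      simp
    have h3 := run_succ_of_alice hs h2
    have h4 : M.bitState ((M.toProtocol.det ω).run x y (t + 1 + 1)).transcript =
        .alice s (a ++ [c]) false := by
      rw [h3]
      simp only [Config.send, bitState_append, h2, bitNext, nextBit, ← ha]
      simp
    have hl1 : ((M.toProtocol.det ω).run x y (t + 1)).last = some .alice := by rw [h1]; rfl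
    have hr1 : ((M.toProtocol.det ω).run x y (t + 1)).rounds ≤ r + 1 := by
      rw [h1]
      rcases hr with hr | ⟨hr, hl⟩
      · exact (rounds_send_le _ _ _).trans (by omega)
      · rw [rounds_send_of_last hl]; exact hr
    have hr2 : ((M.toProtocol.det ω).run x y (t + 1 + 1)).rounds ≤ r + 1 := by
      rw [h3, rounds_send_of_last hl1]; exact hr1
    have := ih (a ++ [c]) (t + 1 + 1) (by simp [← ha]) h4 (Or.inr ⟨hr2, by rw [h3]; rfl⟩)
    rw [List.length_cons, show t + (2 * (l.length + 1) + 1) = t + 1 + 1 + (2 * l.length + 1) by ring]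
    exact this

theorem exists_run_bob {s : M.State} {u : List Bool} (r : ℕ) (l : List Bool) :
    ∀ (a : List Bool) (t : ℕ), a ++ l = M.bob s u y ω →
      M.bitState ((M.toProtocol.det ω).run x y t).transcript = .bob s u a false →
      (((M.toProtocol.det ω).run x y t).rounds ≤ r ∨
        ((M.toProtocol.det ω).run x y t).rounds ≤ r + 1 ∧
        ((M.toProtocol.det ω).run x y t).last = some .bob) →
      M.bitState ((M.toProtocol.det ω).run x y (t + (2 * l.length + 1))).transcript =
        .alice (M.next s u (M.bob s u y ω)) [] false ∧
      ((M.toProtocol.det ω).run x y (t + (2 * l.length + 1))).rounds ≤ r + 1 := by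
  induction l with
  | nil =>
    intro a t ha h hr
    rw [List.append_nil] at ha
    have h1 := run_succ_of_bob h
    simp only [List.length_nil, mul_zero, zero_add]
    rw [h1]
    constructor
    · simp only [Config.send, bitState_append, h, bitNext, nextBit, ha]
      simp
    · rcases hr with hr | ⟨hr, hl⟩
      · exact (rounds_send_le _ _ _).trans (by omega)
      · rw [rounds_send_of_last hl]; exact hr
  | cons c l ih =>
    intro a t ha h hr
    have h1 := run_succ_of_bob h
    have h2 : M.bitState ((M.toProtocol.det ω).run x y (t + 1)).transcript = .bob s u a true := by
      rw [h1]
      simp only [Config.send, bitState_append, h, bitNext, nextBit, ← ha]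
      simp
    have h3 := run_succ_of_bob h2
    have h4 : M.bitState ((M.toProtocol.det ω).run x y (t + 1 + 1)).transcript =
        .bob s u (a ++ [c]) false := by
      rw [h3]
      simp only [Config.send, bitState_append, h2, bitNext, nextBit, ← ha]
      simp
    have hl1 : ((M.toProtocol.det ω).run x y (t + 1)).last = some .bob := by rw [h1]; rfl
    have hr1 : ((M.toProtocol.det ω).run x y (t + 1)).rounds ≤ r + 1 := by
      rw [h1]
      rcases hr with hr | ⟨hr, hl⟩
      · exact (rounds_send_le _ _ _).trans (by omega)
      · rw [rounds_send_of_last hl]; exact hr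
    have hr2 : ((M.toProtocol.det ω).run x y (t + 1 + 1)).rounds ≤ r + 1 := by
      rw [h3, rounds_send_of_last hl1]; exact hr1
    have := ih (a ++ [c]) (t + 1 + 1) (by simp [← ha]) h4 (Or.inr ⟨hr2, by rw [h3]; rfl⟩)
    rw [List.length_cons, show t + (2 * (l.length + 1) + 1) = t + 1 + 1 + (2 * l.length + 1) by ring]
    exact this

theorem length_transcript_run_le {X Y Z : Type*} (P : Protocol X Y Z) (x : X) (y : Y) (t : ℕ) :
    (P.run x y t).transcript.length ≤ t := by
  induction t with
  | zero => simp [Protocol.run]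
  | succ t ih =>
    rw [Protocol.run, Protocol.step]
    split
    · simpa [Config.send] using ih
    · simpa [Config.send] using ih
    · omega

theorem Reaches.exists_run {s s' : M.State} {n b : ℕ} (h : M.Reaches ω x y s n b s') :
    ∀ (t r : ℕ), M.bitState ((M.toProtocol.det ω).run x y t).transcript = .alice s [] false →
      ((M.toProtocol.det ω).run x y t).rounds ≤ r →
      ∃ t' ≤ t + b, M.bitState ((M.toProtocol.det ω).run x y t').transcript = .alice s' [] false ∧
        ((M.toProtocol.det ω).run x y t').rounds ≤ r + 2 * n := by
  induction h with
  | refl s => exact fun t r h hr => ⟨t, le_rfl, h, hr⟩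
  | @step s s' n b c h1 h2 _ ih =>
    intro t r h hr
    obtain ⟨ha, hra⟩ := exists_run_alice h1 r (M.alice s x ω) [] t rfl h (Or.inl hr)
    obtain ⟨hb, hrb⟩ := exists_run_bob (r + 1) (M.bob s (M.alice s x ω) y ω) [] _ rfl ha
      (Or.inl hra)
    obtain ⟨t', ht, h3, h4⟩ := ih _ _ hb hrb
    refine ⟨t', ?_, h3, by omega⟩
    unfold cost at h2
    omega

theorem Reaches.computes {s : M.State} {n b : ℕ} {z : Z} (h : M.Reaches ω x y M.init n b s)
    (hz : M.out s = some z) {r c : ℝ} (hr : ((2 * n : ℕ) : ℝ) ≤ r) (hc : (b : ℝ) ≤ c) :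
    (M.toProtocol.det ω).Computes x y z r c := by
  obtain ⟨t, ht, h1, h2⟩ := h.exists_run 0 0 rfl le_rfl
  refine ⟨t, ?_, ?_, ?_⟩
  · change M.bitNode (M.bitState _) = _
    rw [h1, bitNode, hz]
  · exact le_trans (by exact_mod_cast (by omega : _ ≤ 2 * n)) hr
  · refine le_trans ?_ hc
    have := length_transcript_run_le (M.toProtocol.det ω) x y t
    exact_mod_cast (by omega : _ ≤ b)

theorem Reaches.halts {s : M.State} {n b : ℕ} {z : Z} (h : M.Reaches ω x y M.init n b s)
    (hz : M.out s = some z) : (M.toProtocol.det ω).Halts x y := by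
  obtain ⟨t, h1, _⟩ := h.computes hz le_rfl le_rfl
  exact ⟨t, z, h1⟩

end Machine

end

section

/-! ### Coin tosses and random hash values -/

open ProbabilityTheory ENNReal

instance : IsProbabilityMeasure coinMeasure := by
  unfold coinMeasure
  infer_instance

theorem coinMeasure_coin (i : ℕ) (b : Bool) : coinMeasure {ω | ω i = b} = 2⁻¹ := by
  have h : {ω : ℕ → Bool | ω i = b} = (fun ω => ω i) ⁻¹' {b} := rfl
  have h2 : coinMeasure.map (fun ω : ℕ → Bool => ω i) =
      (PMF.uniformOfFintype Bool).toMeasure := by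
    unfold coinMeasure
    exact Measure.infinitePi_map_eval _ i
  rw [h, ← Measure.map_apply (measurable_pi_apply i) (measurableSet_singleton b), h2,
    PMF.toMeasure_apply_singleton _ _ (measurableSet_singleton b)]
  simp

/-- The σ-algebra generated by the coin tosses with index in `I`. -/
abbrev coinsOn (I : Set ℕ) : MeasurableSpace (ℕ → Bool) :=
  ⨆ i ∈ I, MeasurableSpace.comap (fun ω => ω i) ⊤

theorem coinsOn_le (I : Set ℕ) : coinsOn I ≤ MeasurableSpace.pi :=
  iSup₂_le fun i _ => (measurable_pi_apply i).comap_le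

theorem coinsOn_mono {I I' : Set ℕ} (h : I ⊆ I') : coinsOn I ≤ coinsOn I' :=
  biSup_mono h

theorem coinMeasure_inter {I I' : Set ℕ} (h : Disjoint I I') {A A' : Set (ℕ → Bool)}
    (hA : MeasurableSet[coinsOn I] A) (hA' : MeasurableSet[coinsOn I'] A') :
    coinMeasure (A ∩ A') = coinMeasure A * coinMeasure A' := by
  have h1 : iIndepFun (fun (i : ℕ) (ω : ℕ → Bool) => ω i) coinMeasure :=
    iIndepFun_infinitePi (X := fun _ b => b) (fun _ => measurable_id)
  have h2 := indep_iSup_of_disjoint (fun i => (measurable_pi_apply i).comap_le) h1 h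
  exact (Indep_iff _ _ _).1 h2 A A' hA hA'

variable {β γ : Type*}

/-- The discrete random variable `f` is determined by the coin tosses with index in `I`. -/
def CoinMeasurable (I : Set ℕ) (f : (ℕ → Bool) → β) : Prop :=
  ∀ T : Set β, MeasurableSet[coinsOn I] {ω | f ω ∈ T}

namespace CoinMeasurable

variable {I I' : Set ℕ} {f : (ℕ → Bool) → β} {g : (ℕ → Bool) → γ}

theorem measurableSet (hf : CoinMeasurable I f) (T : Set β) : MeasurableSet {ω | f ω ∈ T} :=
  coinsOn_le I _ (hf T)

theorem mono (hf : CoinMeasurable I f) (h : I ⊆ I') : CoinMeasurable I' f :=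
  fun T => coinsOn_mono h _ (hf T)

theorem const (b : β) : CoinMeasurable I fun _ => b :=
  fun T => @MeasurableSet.const _ (coinsOn I) (b ∈ T)

theorem comp (hf : CoinMeasurable I f) (g : β → γ) : CoinMeasurable I fun ω => g (f ω) :=
  fun T => hf (g ⁻¹' T)

theorem prodMk [Countable β] [Countable γ] (hf : CoinMeasurable I f) (hg : CoinMeasurable I g) :
    CoinMeasurable I fun ω => (f ω, g ω) := by
  intro T
  have : {ω | (f ω, g ω) ∈ T} = ⋃ t ∈ T, {ω | f ω ∈ ({t.1} : Set β)} ∩ {ω | g ω ∈ ({t.2} : Set γ)} := by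
    ext ω
    simp only [Set.mem_ofPred_eq, Set.mem_iUnion, Set.mem_inter_iff, Set.mem_singleton_iff]
    constructor
    · exact fun h => ⟨_, h, rfl, rfl⟩
    · rintro ⟨t, ht, h1, h2⟩
      rw [h1, h2]
      exact ht
  rw [this]
  exact MeasurableSet.biUnion (m := coinsOn I) T.to_countable
    fun t _ => MeasurableSet.inter (m := coinsOn I) (hf _) (hg _)

theorem map₂ [Countable β] [Countable γ] {δ : Type*} (hf : CoinMeasurable I f)
    (hg : CoinMeasurable I g) (F : β → γ → δ) : CoinMeasurable I fun ω => F (f ω) (g ω) :=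
  (hf.prodMk hg).comp fun t => F t.1 t.2

theorem coin {i : ℕ} (hi : i ∈ I) : CoinMeasurable I fun ω => ω i := by
  intro T
  have : MeasurableSpace.comap (fun ω : ℕ → Bool => ω i) ⊤ ≤ coinsOn I :=
    le_iSup₂_of_le (f := fun i _ => MeasurableSpace.comap (fun ω : ℕ → Bool => ω i) ⊤) i hi le_rfl
  exact this _ ⟨T, trivial, rfl⟩

theorem list_map {δ : Type*} [Countable β] {F : δ → (ℕ → Bool) → β} {l : List δ}
    (h : ∀ d ∈ l, CoinMeasurable I (F d)) : CoinMeasurable I fun ω => l.map fun d => F d ω := by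
  induction l with
  | nil => exact const []
  | cons d l ih =>
    exact (h d (by simp)).map₂ (ih fun e he => h e (by simp [he])) List.cons

theorem pi {k : ℕ} [Countable β] {F : Fin k → (ℕ → Bool) → β} (h : ∀ i, CoinMeasurable I (F i)) :
    CoinMeasurable I fun ω i => F i ω := by
  intro T
  have : {ω | (fun i => F i ω) ∈ T} = ⋃ t ∈ T, ⋂ i, {ω | F i ω ∈ ({t i} : Set β)} := by
    ext ω
    simp only [Set.mem_ofPred_eq, Set.mem_iUnion, Set.mem_iInter, Set.mem_singleton_iff]
    constructor
    · exact fun h => ⟨_, h, fun _ => rfl⟩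
    · rintro ⟨t, ht, h⟩
      rwa [funext h]
  rw [this]
  exact MeasurableSet.biUnion (m := coinsOn I) T.to_countable
    fun t _ => MeasurableSet.iInter (m := coinsOn I) fun i => h i _

end CoinMeasurable

/-- A random event that is chosen depending on other coins. -/
theorem coinMeasure_adaptive_le [Countable β] {I I' : Set ℕ} (h : Disjoint I I')
    {f : (ℕ → Bool) → β} (hf : CoinMeasurable I f) {A : β → Set (ℕ → Bool)}
    (hA : ∀ b, MeasurableSet[coinsOn I'] (A b)) {δ : ℝ≥0∞} (hδ : ∀ b, coinMeasure (A b) ≤ δ) :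
    coinMeasure {ω | ω ∈ A (f ω)} ≤ δ := by
  have h1 : {ω | ω ∈ A (f ω)} = ⋃ b, {ω | f ω ∈ ({b} : Set β)} ∩ A b := by
    ext ω
    simp
  rw [h1]
  refine (measure_iUnion_le _).trans ?_
  have h2 : ∀ b, coinMeasure ({ω | f ω ∈ ({b} : Set β)} ∩ A b) ≤
      coinMeasure {ω | f ω ∈ ({b} : Set β)} * δ := fun b => by
    rw [coinMeasure_inter h (hf {b}) (hA b)]
    gcongr
    exact hδ b
  refine (ENNReal.tsum_le_tsum h2).trans ?_
  rw [ENNReal.tsum_mul_right]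
  have h3 : ∑' b, coinMeasure {ω | f ω ∈ ({b} : Set β)} =
      coinMeasure (⋃ b, {ω | f ω ∈ ({b} : Set β)}) := by
    rw [measure_iUnion]
    · intro b b' hbb
      rw [Function.onFun, Set.disjoint_left]
      rintro ω h1 h2
      exact hbb ((show f ω = b from h1).symm.trans (show f ω = b' from h2))
    · exact fun b => hf.measurableSet {b}
  rw [h3]
  calc _ ≤ 1 * δ := by gcongr; exact prob_le_one
    _ = δ := one_mul δ

open Classical in
/-- Markov's inequality for the number of events that occur. -/
theorem coinMeasure_count_le (N : ℕ) (A : ℕ → Set (ℕ → Bool))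
    (hA : ∀ n < N, MeasurableSet (A n)) {δ : ℝ≥0∞} (hδ : ∀ n < N, coinMeasure (A n) ≤ δ) :
    coinMeasure {ω | N < 4 * ((Finset.range N).filter fun n => ω ∈ A n).card} ≤ 4 * δ := by
  rcases Nat.eq_zero_or_pos N with rfl | hN
  · simp
  have hm : ∀ n ∈ Finset.range N, Measurable ((A n).indicator (1 : (ℕ → Bool) → ℝ≥0∞)) :=
    fun n hn => measurable_one.indicator (hA n (Finset.mem_range.1 hn))
  -- The expected number of events is at most `N * δ`, and the threshold is `N / 4`. The events need
  -- not be independent.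
  have h1 := mul_meas_ge_le_lintegral (μ := coinMeasure)
    (f := fun ω => ∑ n ∈ Finset.range N, (A n).indicator (1 : (ℕ → Bool) → ℝ≥0∞) ω)
    (Finset.measurable_fun_sum _ hm) (N / 4)
  rw [lintegral_finsetSum _ hm] at h1
  have h2 : ∑ n ∈ Finset.range N, ∫⁻ ω, (A n).indicator (1 : (ℕ → Bool) → ℝ≥0∞) ω ∂coinMeasure
      ≤ N * δ := by
    calc _ ≤ ∑ n ∈ Finset.range N, δ := by
          refine Finset.sum_le_sum fun n hn => ?_
          rw [lintegral_indicator_one (hA n (Finset.mem_range.1 hn))]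
          exact hδ n (Finset.mem_range.1 hn)
      _ = N * δ := by simp
  have h3 : coinMeasure {ω | N < 4 * ((Finset.range N).filter fun n => ω ∈ A n).card} ≤
      coinMeasure {ω | (N : ℝ≥0∞) / 4 ≤
        ∑ n ∈ Finset.range N, (A n).indicator (1 : (ℕ → Bool) → ℝ≥0∞) ω} := by
    refine measure_mono fun ω hω => ?_
    simp only [Set.mem_ofPred_eq] at hω ⊢
    have h4 : ∑ n ∈ Finset.range N, (A n).indicator (1 : (ℕ → Bool) → ℝ≥0∞) ω =
        (((Finset.range N).filter fun n => ω ∈ A n).card : ℝ≥0∞) := by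
      simp [Set.indicator_apply]
    rw [h4, ENNReal.div_le_iff (by norm_num) (by norm_num)]
    exact_mod_cast (by omega : N ≤ _ * 4)
  have hN0 : (N : ℝ≥0∞) ≠ 0 := by exact_mod_cast hN.ne'
  have h4 : (N : ℝ≥0∞) * coinMeasure {ω | N < 4 * ((Finset.range N).filter fun n => ω ∈ A n).card} ≤
      N * (4 * δ) := by
    calc _ ≤ (N : ℝ≥0∞) * coinMeasure {ω | (N : ℝ≥0∞) / 4 ≤
        ∑ n ∈ Finset.range N, (A n).indicator (1 : (ℕ → Bool) → ℝ≥0∞) ω} := by gcongr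
      _ = 4 * ((N / 4 : ℝ≥0∞) * coinMeasure {ω | (N : ℝ≥0∞) / 4 ≤
        ∑ n ∈ Finset.range N, (A n).indicator (1 : (ℕ → Bool) → ℝ≥0∞) ω}) := by
          rw [← mul_assoc, ENNReal.mul_div_cancel (by norm_num) (by norm_num)]
      _ ≤ 4 * (N * δ) := mul_le_mul_right (h1.trans h2) 4
      _ = N * (4 * δ) := by ring
  exact (ENNReal.mul_le_mul_iff_right hN0 (by simp)).1 h4

/-! ### Hashing -/

variable {α : Type*}

/-- The `m`-bit hash value of `S` in block `t`, where `c` numbers the coins. -/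
def hash (c : (ℕ × ℕ) × ℕ × List α → ℕ) (m : ℕ) (t : ℕ × ℕ) (S : List α) (ω : ℕ → Bool) :
    List Bool :=
  (List.range m).map fun b => ω (c (t, b, S))

/-- The indices of the coins that determine the hash values in block `t`. -/
def block (c : (ℕ × ℕ) × ℕ × List α → ℕ) (t : ℕ × ℕ) : Set ℕ := Set.range fun p => c (t, p)

variable {c : (ℕ × ℕ) × ℕ × List α → ℕ}


@[simp]
theorem length_hash (m : ℕ) (t : ℕ × ℕ) (S : List α) (ω : ℕ → Bool) :
    (hash c m t S ω).length = m := by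
  simp [hash]

theorem coinMeasurable_hash (m : ℕ) (t : ℕ × ℕ) (S : List α) :
    CoinMeasurable (block c t) (hash c m t S) :=
  CoinMeasurable.list_map fun b _ => CoinMeasurable.coin ⟨(b, S), rfl⟩

theorem disjoint_block (hc : Function.Injective c) {t t' : ℕ × ℕ} (h : t ≠ t') :
    Disjoint (block c t) (block c t') := by
  rw [Set.disjoint_left]
  rintro _ ⟨p, rfl⟩ ⟨p', hp⟩
  exact h (Prod.mk.inj (hc hp)).1.symm

theorem coinMeasure_coin_eq_coin {i j : ℕ} (h : i ≠ j) : coinMeasure {ω | ω i = ω j} = 2⁻¹ := by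
  have h1 : ∀ b, coinMeasure ({ω | ω i ∈ ({b} : Set Bool)} ∩ {ω | ω j ∈ ({b} : Set Bool)}) =
      2⁻¹ * 2⁻¹ := fun b => by
    rw [coinMeasure_inter (Set.disjoint_singleton.2 h)
      (CoinMeasurable.coin (Set.mem_singleton i) {b}) (CoinMeasurable.coin (Set.mem_singleton j) {b})]
    exact congrArg₂ _ (coinMeasure_coin i b) (coinMeasure_coin j b)
  have h2 : {ω : ℕ → Bool | ω i = ω j} =
      ({ω | ω i ∈ ({true} : Set Bool)} ∩ {ω | ω j ∈ ({true} : Set Bool)}) ∪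
      ({ω | ω i ∈ ({false} : Set Bool)} ∩ {ω | ω j ∈ ({false} : Set Bool)}) := by
    ext ω
    simp only [Set.mem_ofPred_eq, Set.mem_singleton_iff, Set.mem_union, Set.mem_inter_iff]
    cases ω i <;> cases ω j <;> simp
  rw [h2, measure_union, h1, h1, ← mul_add, ENNReal.inv_two_add_inv_two, mul_one]
  · rw [Set.disjoint_left]
    rintro ω ⟨h1, _⟩ ⟨h2, _⟩
    simp only [Set.mem_ofPred_eq, Set.mem_singleton_iff] at h1 h2
    simp [h1] at h2
  · exact ((measurable_pi_apply i) (measurableSet_singleton _)).inter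
      ((measurable_pi_apply j) (measurableSet_singleton _))

/-- Distinct strings read distinct coins, so each bit agrees with probability `1/2`. Bit `m` uses
coins disjoint from those of the earlier bits, so the probabilities multiply. -/
theorem coinMeasure_hash_eq_hash (hc : Function.Injective c) (m : ℕ) (t : ℕ × ℕ) {S S' : List α}
    (h : S ≠ S') : coinMeasure {ω | hash c m t S ω = hash c m t S' ω} = 2⁻¹ ^ m := by
  induction m with
  | zero => simp [hash]
  | succ m ih =>
    have h1 : {ω | hash c (m + 1) t S ω = hash c (m + 1) t S' ω} =
        {ω | hash c m t S ω = hash c m t S' ω} ∩ {ω | ω (c (t, m, S)) = ω (c (t, m, S'))} := by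
      ext ω
      simp [hash, List.range_succ]
    have hm : ∀ S, CoinMeasurable {i | ∃ b < m, ∃ S, i = c (t, b, S)} (hash c m t S) := fun S =>
      CoinMeasurable.list_map fun b hb => CoinMeasurable.coin ⟨b, List.mem_range.1 hb, S, rfl⟩
    have hm' : ∀ S, CoinMeasurable {i | ∃ S, i = c (t, m, S)} fun ω => ω (c (t, m, S)) := fun S =>
      CoinMeasurable.coin ⟨S, rfl⟩
    rw [h1, coinMeasure_inter _ ((hm S).map₂ (hm S') (fun a b => a = b) {True} |> fun h => by
        simpa using h) ((hm' S).map₂ (hm' S') (fun a b => a = b) {True} |> fun h => by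
        simpa using h), ih, coinMeasure_coin_eq_coin, pow_succ]
    · intro he
      have := hc he
      simp only [Prod.mk.injEq, true_and] at this
      exact h this
    · rw [Set.disjoint_left]
      rintro _ ⟨b, hb, S, rfl⟩ ⟨S', he⟩
      have := hc he
      simp only [Prod.mk.injEq, true_and] at this
      omega

end

section

open ENNReal

variable {α : Type*} {k : ℕ}

/-! ### Testing whether the first phrases agree -/

/-- Alice's message for the test whether the first `j` phrases agree. -/
def query (c : (ℕ × ℕ) × ℕ × List α → ℕ) (m : ℕ) (A : List α) (t : ℕ × ℕ) (j : ℕ) (ω : ℕ → Bool) :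
    List Bool :=
  decide (boundary A j ≤ A.length) :: hash c m t (A.take (boundary A j)) ω

open Classical in
/-- Bob's answer in the test whether the first `j` phrases agree. -/
def answer (c : (ℕ × ℕ) × ℕ × List α → ℕ) (m : ℕ) (B : Fin k → List α) (t : ℕ × ℕ) (j : ℕ)
    (a : List Bool) (ω : ℕ → Bool) : Bool :=
  decide (∃ i, boundary (B i) j ≤ (B i).length ∧
    a = true :: hash c m t ((B i).take (boundary (B i) j)) ω)

/-- The outcome of the test whether the first `j` phrases agree. -/
def test (c : (ℕ × ℕ) × ℕ × List α → ℕ) (m : ℕ) (A : List α) (B : Fin k → List α) (t : ℕ × ℕ)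
    (j : ℕ) (ω : ℕ → Bool) : Bool :=
  answer c m B t j (query c m A t j ω) ω

variable {c : (ℕ × ℕ) × ℕ × List α → ℕ} {m : ℕ} {A : List α} {B : Fin k → List α}

@[simp]
theorem length_query (t : ℕ × ℕ) (j : ℕ) (ω : ℕ → Bool) : (query c m A t j ω).length = m + 1 := by
  simp [query]

theorem coinMeasurable_query (t : ℕ × ℕ) (j : ℕ) :
    CoinMeasurable (block c t) (query c m A t j) :=
  (coinMeasurable_hash m t _).comp _

theorem coinMeasurable_answer (t : ℕ × ℕ) (j : ℕ) (a : List Bool) :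
    CoinMeasurable (block c t) (answer c m B t j a) := by
  classical
  exact (CoinMeasurable.pi fun i => coinMeasurable_hash m t ((B i).take (boundary (B i) j))).comp
    fun h => decide (∃ i, boundary (B i) j ≤ (B i).length ∧ a = true :: h i)

theorem coinMeasurable_test (t : ℕ × ℕ) (j : ℕ) : CoinMeasurable (block c t) (test c m A B t j) := by
  classical
  exact (coinMeasurable_query t j).map₂ (CoinMeasurable.pi fun i =>
      coinMeasurable_hash m t ((B i).take (boundary (B i) j)))
    fun a h => decide (∃ i, boundary (B i) j ≤ (B i).length ∧ a = true :: h i)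

theorem test_eq_true_iff (t : ℕ × ℕ) (j : ℕ) (ω : ℕ → Bool) :
    test c m A B t j ω = true ↔ boundary A j ≤ A.length ∧ ∃ i, boundary (B i) j ≤ (B i).length ∧
      hash c m t (A.take (boundary A j)) ω = hash c m t ((B i).take (boundary (B i) j)) ω := by
  simp only [test, answer, query, decide_eq_true_eq, List.cons.injEq]
  constructor
  · rintro ⟨i, h1, h2, h3⟩
    exact ⟨h2, i, h1, h3⟩
  · rintro ⟨h2, i, h1, h3⟩
    exact ⟨i, h1, h2, h3⟩

/-- The error is one-sided: equal prefixes have equal hashes whatever the coins. -/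
theorem test_of_le (hk : 1 ≤ k) (t : ℕ × ℕ) {j : ℕ} (hj : j ≤ commonPhrases A B) (ω : ℕ → Bool) :
    test c m A B t j ω = true := by
  rw [← boundary_le_lcpMax_iff, boundary_le_lcpMax_iff_exists A B hk] at hj
  obtain ⟨h1, i, h2, h3⟩ := hj
  exact (test_eq_true_iff t j ω).2 ⟨h1, i, h2, by rw [h3]⟩

theorem coinMeasure_exists_hash_eq_le (hc : Function.Injective c) (t : ℕ × ℕ) (S : List α)
    (F : Fin k → List α) :
    coinMeasure {ω | ∃ i, F i ≠ S ∧ hash c m t (F i) ω = hash c m t S ω} ≤ k * 2⁻¹ ^ m := by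
  have : {ω | ∃ i, F i ≠ S ∧ hash c m t (F i) ω = hash c m t S ω} =
      ⋃ i, {ω | F i ≠ S ∧ hash c m t (F i) ω = hash c m t S ω} := by
    ext ω
    simp
  rw [this]
  refine (measure_iUnion_le _).trans ?_
  rw [tsum_fintype]
  calc _ ≤ ∑ _i : Fin k, (2⁻¹ : ℝ≥0∞) ^ m := by
        refine Finset.sum_le_sum fun i _ => ?_
        by_cases h : F i = S
        · simp [h]
        · rw [← coinMeasure_hash_eq_hash hc m t h]
          exact measure_mono fun ω hω => hω.2
    _ = k * 2⁻¹ ^ m := by simp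

theorem coinMeasure_test_le (hk : 1 ≤ k) (hc : Function.Injective c) (t : ℕ × ℕ) {j : ℕ}
    (hj : commonPhrases A B < j) :
    coinMeasure {ω | test c m A B t j ω = true} ≤ k * 2⁻¹ ^ m := by
  refine le_trans (measure_mono ?_) (coinMeasure_exists_hash_eq_le hc t (A.take (boundary A j))
    fun i => (B i).take (boundary (B i) j))
  intro ω hω
  obtain ⟨h1, i, h2, h3⟩ := (test_eq_true_iff t j ω).1 hω
  refine ⟨i, fun h4 => ?_, h3.symm⟩
  have := (boundary_le_lcpMax_iff_exists A B hk j).2 ⟨h1, i, h2, h4⟩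
  rw [boundary_le_lcpMax_iff] at this
  omega

/-! ### Binary search with false positives -/

/-! The search state is a decreasing list: its head is an upper bound, the next entry is the current
lower bound, and the remaining entries are the previous lower bounds. -/

/-- The current lower bound. -/
def lowQuery (l : List ℕ) : ℕ := l.getD 1 0

/-- The middle of the current interval. -/
def midQuery (l : List ℕ) : ℕ := (l.getD 0 0 + l.getD 1 0) / 2

/-- One step of the search: `low` and `mid` are the outcomes of the tests of the current lower bound
and of the middle of the current interval. A lower bound that fails becomes the upper bound. -/
def searchNext : List ℕ → Bool → Bool → List ℕ
  | hi :: lo :: r, low, mid =>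
    if low then
      if hi ≤ lo + 1 then hi :: lo :: r
      else if mid then hi :: (hi + lo) / 2 :: lo :: r else (hi + lo) / 2 :: lo :: r
    else lo :: r
  | l, _, _ => l

/-- `Potential J n l` states that in state `l` the search for `J` is done after at most `n` steps
without a false positive. -/
inductive Potential (J : ℕ) : ℕ → List ℕ → Prop
  | base {d h g : ℕ} (r : List ℕ) : J < h → g ≤ J → h ≤ g + 2 ^ d → Potential J d (h :: g :: r)
  | cons {n b : ℕ} {l : List ℕ} : J < b → Potential J n l → Potential J (n + 1) (b :: l)

theorem Potential.exists_cons {J n : ℕ} {l : List ℕ} (h : Potential J n l) :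
    ∃ b l', l = b :: l' ∧ J < b := by
  cases h with
  | base r h1 _ _ => exact ⟨_, _, rfl, h1⟩
  | cons h1 _ => exact ⟨_, _, rfl, h1⟩

theorem Potential.lowQuery_eq {J : ℕ} {l : List ℕ} (h : Potential J 0 l) : lowQuery l = J := by
  cases h with
  | base r h1 h2 h3 => simp only [lowQuery, List.getD_cons_succ, List.getD_cons_zero]; omega

/-- A test outcome is wrong in state `l`. -/
def FalsePositive (J : ℕ) (l : List ℕ) (low mid : Bool) : Prop :=
  (J < lowQuery l ∧ low = true) ∨ (J < midQuery l ∧ mid = true)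

/-- In a `base` state the interval really contains `J`, and a correct step halves it. A false
positive puts a wrong lower bound below the head, which turns the head into a `cons` layer. In a
`cons` state a correct test rejects the current lower bound and removes one layer; a false positive
adds at most one. The clause `0 < n` says that a finished search cannot be spoiled: all numbers
tested then are at most `J`, and such tests never fail. -/
theorem Potential.searchNext {J n : ℕ} {l : List ℕ} {low mid : Bool} (h : Potential J n l)
    (hlow : lowQuery l ≤ J → low = true) (hmid : midQuery l ≤ J → mid = true) :
    ∃ n', Potential J n' (searchNext l low mid) ∧
      (¬ FalsePositive J l low mid → n' ≤ n - 1) ∧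
      (FalsePositive J l low mid → n' ≤ n + 1 ∧ 0 < n) := by
  cases h with
  | @base d h g r h1 h2 h3 =>
    simp only [lowQuery, midQuery, List.getD_cons_succ, List.getD_cons_zero, FalsePositive] at *
    have hl := hlow h2
    subst hl
    by_cases hg : h ≤ g + 1
    · have hm := hmid (by omega)
      refine ⟨0, ?_, fun _ => Nat.zero_le _, fun hf => ?_⟩
      · simp only [LZComm.searchNext, hg, if_true]
        exact .base r h1 h2 (by simpa using hg)
      · omega
    · obtain ⟨d, rfl⟩ : ∃ d, n = d + 1 := by
        cases n with
        | zero => simp at h3; omega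
        | succ d => exact ⟨d, rfl⟩
      rw [pow_succ] at h3
      rcases le_or_gt ((h + g) / 2) J with hJ | hJ
      · have hm := hmid hJ
        subst hm
        refine ⟨d, ?_, fun _ => by omega, fun _ => by omega⟩
        simp only [LZComm.searchNext, hg, if_true, if_false]
        exact .base _ h1 hJ (by omega)
      · cases mid with
        | false =>
          refine ⟨d, ?_, fun _ => by omega, fun _ => by omega⟩
          simp only [LZComm.searchNext, hg, if_true, if_false]
          exact .base _ hJ h2 (by omega)
        | true =>
          refine ⟨d + 1, ?_, fun hf => ?_, fun _ => by omega⟩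
          · simp only [LZComm.searchNext, hg, if_true, if_false]
            exact .cons h1 (.base _ hJ h2 (by omega))
          · exact absurd (Or.inr ⟨hJ, rfl⟩) hf
  | @cons n b l hb hl =>
    obtain ⟨b', l', rfl, hb'⟩ := hl.exists_cons
    simp only [lowQuery, midQuery, List.getD_cons_succ, List.getD_cons_zero, FalsePositive] at *
    have hm : J < (b + b') / 2 := by omega
    cases low with
    | false =>
      exact ⟨n, by simpa [LZComm.searchNext] using hl, fun _ => by omega, fun _ => by omega⟩
    | true =>
      simp only [LZComm.searchNext, if_true]
      split_ifs with h1 h2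
      · exact ⟨n + 1, .cons hb hl, fun hf => absurd (Or.inl ⟨hb', trivial⟩) hf, fun _ => by omega⟩
      · exact ⟨n + 2, .cons hb (.cons hm hl), fun hf => absurd (Or.inl ⟨hb', trivial⟩) hf,
          fun _ => by omega⟩
      · exact ⟨n + 1, .cons hm hl, fun hf => absurd (Or.inl ⟨hb', trivial⟩) hf, fun _ => by omega⟩

/-- The states of the search for the number of common phrases, starting from the bound `2 ^ T`. -/
def search (c : (ℕ × ℕ) × ℕ × List α → ℕ) (m : ℕ) (A : List α) (B : Fin k → List α) (T : ℕ)
    (ω : ℕ → Bool) : ℕ → List ℕ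
  | 0 => [2 ^ T, 0]
  | n + 1 => searchNext (search c m A B T ω n)
      (test c m A B (1, n) (lowQuery (search c m A B T ω n)) ω)
      (test c m A B (1, n) (midQuery (search c m A B T ω n)) ω)

/-- The set of coin sequences with a false positive in the `n`-th step from state `l`. -/
def badStep (c : (ℕ × ℕ) × ℕ × List α → ℕ) (m : ℕ) (A : List α) (B : Fin k → List α) (n : ℕ)
    (l : List ℕ) : Set (ℕ → Bool) :=
  {ω | FalsePositive (commonPhrases A B) l (test c m A B (1, n) (lowQuery l) ω)
    (test c m A B (1, n) (midQuery l) ω)}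

theorem measurableSet_badStep (n : ℕ) (l : List ℕ) :
    MeasurableSet[coinsOn (block c (1, n))] (badStep c m A B n l) := by
  have h0 := fun j => coinMeasurable_test (c := c) (m := m) (A := A) (B := B) (1, n) j
  have h := (h0 (lowQuery l)).map₂ (h0 (midQuery l)) (FalsePositive (commonPhrases A B) l) {True}
  simpa [badStep] using h

/-- The two tests of a step share their coins; a union bound suffices. -/
theorem coinMeasure_badStep_le (hk : 1 ≤ k) (hc : Function.Injective c) (n : ℕ) (l : List ℕ) :
    coinMeasure (badStep c m A B n l) ≤ 2 * (k * 2⁻¹ ^ m) := by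
  have h : ∀ j, coinMeasure {ω | commonPhrases A B < j ∧ test c m A B (1, n) j ω = true} ≤
      k * 2⁻¹ ^ m := fun j => by
    by_cases hj : commonPhrases A B < j
    · simpa [hj] using coinMeasure_test_le (m := m) hk hc (1, n) hj
    · simp [hj]
  calc coinMeasure (badStep c m A B n l) ≤ _ := measure_union_le _ _
    _ ≤ k * 2⁻¹ ^ m + k * 2⁻¹ ^ m := add_le_add (h _) (h _)
    _ = 2 * (k * 2⁻¹ ^ m) := (two_mul _).symm

theorem coinMeasurable_search (T n : ℕ) : CoinMeasurable (⋃ i < n, block c (1, i))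
    fun ω => search c m A B T ω n := by
  induction n with
  | zero => exact CoinMeasurable.const _
  | succ n ih =>
    have h0 : (⋃ i < n, block c (1, i)) ⊆ ⋃ i < n + 1, block c (1, i) :=
      Set.biUnion_subset_biUnion_left fun i (hi : i < n) => (Nat.lt_succ_of_lt hi : i < n + 1)
    have h1 : block c (1, n) ⊆ ⋃ i < n + 1, block c (1, i) :=
      Set.subset_biUnion_of_mem (u := fun i => block c (1, i)) (Nat.lt_succ_self n : n < n + 1)
    intro U
    -- The numbers tested depend on the previous state, so the event is split over the countably
    -- many values of that state.
    have : {ω | search c m A B T ω (n + 1) ∈ U} = ⋃ l : List ℕ,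
        {ω | search c m A B T ω n ∈ ({l} : Set (List ℕ))} ∩
        {ω | searchNext l (test c m A B (1, n) (lowQuery l) ω) (test c m A B (1, n) (midQuery l) ω)
          ∈ U} := by
      ext ω
      simp [search]
    rw [this]
    refine MeasurableSet.iUnion (m := coinsOn _) fun l => MeasurableSet.inter (m := coinsOn _)
      (ih.mono h0 _) ?_
    exact (((coinMeasurable_test (1, n) (lowQuery l)).map₂ (coinMeasurable_test (1, n) (midQuery l))
      (searchNext l)).mono h1) U

/-- The state before step `n` depends only on earlier blocks of coins, and the tests in step `n` use
a fresh block. -/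
theorem coinMeasure_badStep_search_le (hk : 1 ≤ k) (hc : Function.Injective c) (T n : ℕ) :
    coinMeasure {ω | ω ∈ badStep c m A B n (search c m A B T ω n)} ≤ 2 * (k * 2⁻¹ ^ m) := by
  refine coinMeasure_adaptive_le (I' := block c (1, n)) ?_ (coinMeasurable_search T n)
    (measurableSet_badStep n) (coinMeasure_badStep_le hk hc n)
  rw [Set.disjoint_iUnion₂_left]
  intro i hi
  exact disjoint_block hc (by simp [hi.ne])

theorem measurableSet_badStep_search (T n : ℕ) :
    MeasurableSet {ω | ω ∈ badStep c m A B n (search c m A B T ω n)} := by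
  have : {ω | ω ∈ badStep c m A B n (search c m A B T ω n)} =
      ⋃ l, {ω | search c m A B T ω n ∈ ({l} : Set (List ℕ))} ∩ badStep c m A B n l := by
    ext ω
    simp
  rw [this]
  exact MeasurableSet.iUnion fun l => ((coinMeasurable_search T n).measurableSet {l}).inter
    (coinsOn_le _ _ (measurableSet_badStep n l))

open Classical in
theorem potential_search (hk : 1 ≤ k) {T : ℕ} (hT : commonPhrases A B < 2 ^ T) (ω : ℕ → Bool)
    (n : ℕ) : ∃ q, Potential (commonPhrases A B) q (search c m A B T ω n) ∧
      (q = 0 ∨ q + n ≤ T + 2 * ((Finset.range n).filter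
        fun i => ω ∈ badStep c m A B i (search c m A B T ω i)).card) := by
  induction n with
  | zero => exact ⟨T, .base [] hT (Nat.zero_le _) (by simp), by simp⟩
  | succ n ih =>
    obtain ⟨q, hq, h⟩ := ih
    obtain ⟨q', hq', h1, h2⟩ := hq.searchNext
      (low := test c m A B (1, n) (lowQuery (search c m A B T ω n)) ω)
      (mid := test c m A B (1, n) (midQuery (search c m A B T ω n)) ω)
      (fun h => test_of_le hk _ h ω) (fun h => test_of_le hk _ h ω)
    refine ⟨q', hq', ?_⟩
    rw [Finset.range_add_one, Finset.filter_insert]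
    by_cases hb : ω ∈ badStep c m A B n (search c m A B T ω n)
    · rw [if_pos hb, Finset.card_insert_of_notMem (by simp)]
      have := h2 hb
      omega
    · rw [if_neg hb]
      have := h1 hb
      omega

open Classical in
-- With at most `T / 2` bad steps among `2 * T`, a positive potential `q` would satisfy `q + 2 * T ≤
-- T + T`.
theorem lowQuery_search (hk : 1 ≤ k) {T : ℕ} (hT : commonPhrases A B < 2 ^ T) {ω : ℕ → Bool}
    (h : 4 * ((Finset.range (2 * T)).filter
      fun i => ω ∈ badStep c m A B i (search c m A B T ω i)).card ≤ 2 * T) :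
    lowQuery (search c m A B T ω (2 * T)) = commonPhrases A B := by
  obtain ⟨q, hq, h1⟩ := potential_search (c := c) (m := m) hk hT ω (2 * T)
  obtain rfl : q = 0 := by omega
  exact hq.lowQuery_eq

end

section

open ENNReal

variable {α : Type*} {k : ℕ}

/-! ### The protocol -/

/-- The number with the given binary digits, least significant digit first. -/
def ofBits (l : List Bool) : ℕ := l.foldr Nat.bit 0

theorem ofBits_bits (n : ℕ) : ofBits n.bits = n := by
  induction n using Nat.binaryRec' with
  | zero => simp [ofBits]
  | bit b n h ih =>
    rw [Nat.bits_append_bit n b h]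
    simpa [ofBits] using congrArg (Nat.bit b) ih

/-- The least `t` for which the binary length of `n` is less than `2 ^ t`. -/
def level (n : ℕ) : ℕ := n.size.size

theorem lt_two_pow_level (n : ℕ) : n < 2 ^ 2 ^ level n :=
  (Nat.lt_size_self n).trans_le (Nat.pow_le_pow_right two_pos (Nat.lt_size_self n.size).le)

theorem level_mono : Monotone level := fun _ _ h => Nat.size_le_size (Nat.size_le_size h)

/-- A source of the phrase that starts at position `p`, and `0` if `p = 0`. -/
def source (A : List α) (p : ℕ) : ℕ :=
  if h : 0 < p then (exists_lcp_drop_eq_matchLength A h).choose else 0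

theorem source_lt (A : List α) {p : ℕ} (h : 0 < p) : source A p < p := by
  rw [source, dif_pos h]
  exact (exists_lcp_drop_eq_matchLength A h).choose_spec.1

theorem lcp_drop_source (A : List α) {p : ℕ} (h : 0 < p) :
    lcp (A.drop (source A p)) (A.drop p) = matchLength A p := by
  rw [source, dif_pos h]
  exact (exists_lcp_drop_eq_matchLength A h).choose_spec.2

open Classical in
/-- How long one of Bob's strings whose prefix of length `p` has the hash value `h` continues from
position `p` by a copy from position `s`. -/
def bobLength (c : (ℕ × ℕ) × ℕ × List α → ℕ) (m : ℕ) (B : Fin k → List α) (p s : ℕ) (h : List Bool)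
    (ω : ℕ → Bool) : ℕ :=
  Finset.univ.sup fun i =>
    if p ≤ (B i).length ∧ hash c m (2, 0) ((B i).take p) ω = h then
      lcp ((B i).drop s) ((B i).drop p) else 0

theorem coinMeasurable_bobLength (c : (ℕ × ℕ) × ℕ × List α → ℕ) (m : ℕ) (B : Fin k → List α)
    (p s : ℕ) (h : List Bool) : CoinMeasurable Set.univ (bobLength c m B p s h) := by
  classical
  exact ((CoinMeasurable.pi fun i => coinMeasurable_hash m (2, 0) ((B i).take p)).mono
    (Set.subset_univ _)).comp fun f => Finset.univ.sup fun i =>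
    if p ≤ (B i).length ∧ f i = h then lcp ((B i).drop s) ((B i).drop p) else 0

/-- Without a collision, the strings that Bob selects are those that agree with `A` up to `p`. By
maximality of `commonPhrases` the next phrase of `A` is not completed within `ℓ`, so
`lcp_eq_add_min` applies to each of them. -/
theorem add_min_bobLength {c : (ℕ × ℕ) × ℕ × List α → ℕ} {m : ℕ} {A : List α} {B : Fin k → List α}
    (hk : 1 ≤ k) {p : ℕ} (hp : p = boundary A (commonPhrases A B)) {ω : ℕ → Bool}
    (hω : ¬ ∃ i, (B i).take p ≠ A.take p ∧
      hash c m (2, 0) ((B i).take p) ω = hash c m (2, 0) (A.take p) ω) :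
    p + min (matchLength A p) (bobLength c m B p (source A p) (hash c m (2, 0) (A.take p) ω) ω) =
      lcpMax A B := by
  classical
  have h1 : p ≤ lcpMax A B := hp ▸ (boundary_le_lcpMax_iff A B _).2 le_rfl
  have h2 : lcpMax A B ≤ p + matchLength A p := by
    by_contra hlt
    have h3 : boundary A (commonPhrases A B + 1) ≤ lcpMax A B := by
      simp only [boundary, ← hp]
      omega
    rw [boundary_le_lcpMax_iff] at h3
    omega
  have hpA : p ≤ A.length := h1.trans (lcpMax_le_length A B)
  -- The first phrase has no source: its match length is `0`, which forces `ℓ = 0`.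
  rcases Nat.eq_zero_or_pos p with h0 | h0
  · subst h0
    simp only [matchLength, Finset.range_zero, Finset.sup_empty, Nat.bot_eq_zero] at h2 ⊢
    omega
  have hmatch : ∀ i, (p ≤ (B i).length ∧
      hash c m (2, 0) ((B i).take p) ω = hash c m (2, 0) (A.take p) ω) ↔ p ≤ lcp A (B i) := by
    intro i
    constructor
    · rintro ⟨h3, h4⟩
      have h5 : (B i).take p = A.take p := by
        by_contra h6
        exact hω ⟨i, h6, h4⟩
      exact le_lcp_iff.2 ⟨hpA, (take_eq_take_iff_getElem? _ _ _).1 h5.symm⟩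
    · intro h3
      refine ⟨h3.trans (lcp_le_right _ _), ?_⟩
      rw [(take_eq_take_iff_getElem? _ _ _).2 (le_lcp_iff.1 h3).2]
  have hi : ∀ i, p ≤ lcp A (B i) → lcp A (B i) =
      p + min (matchLength A p) (lcp ((B i).drop (source A p)) ((B i).drop p)) := by
    intro i h
    rw [← lcp_drop_source A h0]
    refine lcp_eq_add_min (source_lt A h0) h ?_
    rw [lcp_drop_source A h0]
    exact (lcp_le_lcpMax A B i).trans h2
  apply le_antisymm
  · have : min (matchLength A p)
        (bobLength c m B p (source A p) (hash c m (2, 0) (A.take p) ω) ω) ≤ lcpMax A B - p := by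
      unfold bobLength
      rw [Finset.sup_inf_distrib_left]
      refine Finset.sup_le fun i _ => ?_
      split_ifs with h
      · have h3 := hi i ((hmatch i).1 h)
        have h4 := lcp_le_lcpMax A B i
        change min _ _ ≤ _
        omega
      · simp
    omega
  · obtain ⟨i, h3⟩ := exists_lcp_eq_lcpMax A B hk
    have h4 : p ≤ lcp A (B i) := h3 ▸ h1
    rw [← h3, hi i h4]
    gcongr
    refine le_trans ?_ (Finset.le_sup (Finset.mem_univ i))
    rw [if_pos ((hmatch i).2 h4)]

/-- The stages of the protocol. In `gallop i` the first `2 ^ i` phrases are compared. In `walk N n l`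
the `n`-th of `N` steps of the search is made from state `l`. In `locate j` Alice announces the
position behind the first `j` phrases and the source of the next phrase. In `double p s h t` and
`estimate p s h` the parties agree on a `t` such that the shorter of their continuations has length
less than `2 ^ 2 ^ t`, and in `compare p s h t` they exchange the lengths. -/
inductive Stage
  | gallop (i : ℕ)
  | walk (N n : ℕ) (l : List ℕ)
  | locate (j : ℕ)
  | double (p s : ℕ) (h : List Bool) (t : ℕ)
  | estimate (p s : ℕ) (h : List Bool)
  | compare (p s : ℕ) (h : List Bool) (t : ℕ)
  | done (z : ℕ)

def Stage.result : Stage → Option ℕ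
  | .done z => some z
  | _ => none

/-- The stage before the `n`-th of `N` search steps, if there is such a step. -/
def enterWalk (N n : ℕ) (l : List ℕ) : Stage :=
  if n < N then .walk N n l else .locate (lowQuery l)

section

variable (c : (ℕ × ℕ) × ℕ × List α → ℕ) (m : ℕ) (v : Bool)

/-- Alice's message. -/
def aliceMessage (A : List α) (ω : ℕ → Bool) : Stage → List Bool
  | .gallop i => query c m A (0, i) (2 ^ i) ω
  | .walk _ n l => query c m A (1, n) (lowQuery l) ω ++ query c m A (1, n) (midQuery l) ω
  | .locate j => hash c m (2, 0) (A.take (boundary A j)) ω ++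
      (Nat.pair (boundary A j) (source A (boundary A j))).bits
  | .double p _ _ t => [decide (level (matchLength A p) ≤ t)]
  | .estimate p _ _ => (level (matchLength A p)).bits
  | .compare p _ _ t => (min (matchLength A p) (2 ^ 2 ^ t)).bits
  | .done _ => []

/-- Bob's reply to Alice's message `a`. -/
def bobMessage (B : Fin k → List α) (a : List Bool) (ω : ℕ → Bool) : Stage → List Bool
  | .gallop i => [answer c m B (0, i) (2 ^ i) a ω]
  | .walk _ n l => [answer c m B (1, n) (lowQuery l) (a.take (m + 1)) ω,
      answer c m B (1, n) (midQuery l) (a.drop (m + 1)) ω]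
  | .locate _ => []
  | .double p s h t => [decide (level (bobLength c m B p s h ω) ≤ t)]
  | .estimate p s h => (min (ofBits a) (level (bobLength c m B p s h ω))).bits
  | .compare p s h t => (min (bobLength c m B p s h ω) (2 ^ 2 ^ t)).bits
  | .done _ => []

/-- The stage after Alice's message `a` and Bob's reply `b`. -/
def nextStage (a b : List Bool) : Stage → Stage
  | .gallop i => if b.getD 0 false then .gallop (i + 1) else enterWalk (2 * i) 0 [2 ^ i, 0]
  | .walk N n l => enterWalk N (n + 1) (searchNext l (b.getD 0 false) (b.getD 1 false))
  | .locate _ =>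
    let q := Nat.unpair (ofBits (a.drop m))
    if v then .double q.1 q.2 (a.take m) 0 else .estimate q.1 q.2 (a.take m)
  | .double p s h t => if a.getD 0 false || b.getD 0 false then .compare p s h t
      else .double p s h (t + 1)
  | .estimate p s h => .compare p s h (ofBits b)
  | .compare p _ _ _ => .done (p + min (ofBits a) (ofBits b))
  | .done z => .done z

theorem coinMeasurable_aliceMessage (A : List α) (s : Stage) :
    CoinMeasurable Set.univ fun ω => aliceMessage c m A ω s := by
  cases s with
  | gallop i => exact (coinMeasurable_query _ _).mono (Set.subset_univ _)
  | walk N n l =>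
    exact ((coinMeasurable_query (1, n) (lowQuery l)).map₂
      (coinMeasurable_query (1, n) (midQuery l)) (· ++ ·)).mono (Set.subset_univ _)
  | locate j => exact ((coinMeasurable_hash m _ _).mono (Set.subset_univ _)).comp (· ++ _)
  | _ => exact CoinMeasurable.const _

theorem coinMeasurable_bobMessage (B : Fin k → List α) (a : List Bool) (s : Stage) :
    CoinMeasurable Set.univ fun ω => bobMessage c m B a ω s := by
  cases s with
  | gallop i => exact ((coinMeasurable_answer _ _ _).mono (Set.subset_univ _)).comp fun b => [b]
  | walk N n l =>
    exact ((coinMeasurable_answer (1, n) (lowQuery l) _).map₂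
      (coinMeasurable_answer (1, n) (midQuery l) _) fun b b' => [b, b']).mono (Set.subset_univ _)
  | double p s h t => exact (coinMeasurable_bobLength c m B p s h).comp fun M => [decide (level M ≤ t)]
  | estimate p s h =>
    exact (coinMeasurable_bobLength c m B p s h).comp fun M => (min (ofBits a) (level M)).bits
  | compare p s h t =>
    exact (coinMeasurable_bobLength c m B p s h).comp fun M => (min M (2 ^ 2 ^ t)).bits
  | _ => exact CoinMeasurable.const _

/-- The protocol for the longest common prefix with one of `k` strings. If `v` holds, then the
magnitude of the last copy is found by repeated squaring, and otherwise Alice announces it. -/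
def lcpMachine (k : ℕ) : Machine (List α) (Fin k → List α) ℕ where
  State := Stage
  init := .gallop 0
  out := Stage.result
  alice s A ω := aliceMessage c m A ω s
  bob s a B ω := bobMessage c m B a ω s
  next s a b := nextStage m v a b s
  measurableSet_alice s A l := (coinMeasurable_aliceMessage c m A s).measurableSet {l}
  measurableSet_bob s a B l := (coinMeasurable_bobMessage c m B a s).measurableSet {l}

end

/-! ### Runs of the protocol and their cost -/

section Run

variable {c : (ℕ × ℕ) × ℕ × List α → ℕ} {m : ℕ} {v : Bool} {A : List α} {B : Fin k → List α}
  {ω : ℕ → Bool}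

theorem reaches_of_next {s s' : Stage} {e : ℕ} (h1 : s.result = none)
    (h2 : 2 * (aliceMessage c m A ω s).length + 1 +
      (2 * (bobMessage c m B (aliceMessage c m A ω s) ω s).length + 1) ≤ e)
    (h3 : nextStage m v (aliceMessage c m A ω s) (bobMessage c m B (aliceMessage c m A ω s) ω s) s
      = s') :
    (lcpMachine c m v k).Reaches ω A B s 1 e s' := by
  subst h3
  exact Machine.Reaches.single (M := lcpMachine c m v k) h1 h2

theorem reaches_gallop (T : ℕ) (h : ∀ i < T, test c m A B (0, i) (2 ^ i) ω = true) :
    (lcpMachine c m v k).Reaches ω A B (.gallop 0) T (T * (2 * m + 6)) (.gallop T) := by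
  induction T with
  | zero => simpa using Machine.Reaches.refl (M := lcpMachine c m v k) (Stage.gallop 0)
  | succ T ih =>
    have h1 := ih fun i hi => h i (by omega)
    rw [Nat.succ_mul]
    refine h1.trans (reaches_of_next rfl ?_ ?_)
    · simp only [aliceMessage, bobMessage, length_query, List.length_cons, List.length_nil]
      omega
    · have := h T (by omega)
      simp only [test] at this
      simp only [aliceMessage, bobMessage, nextStage, List.getD_cons_zero, this, if_true]

theorem reaches_walk {T : ℕ} (N n d : ℕ) (h : n + d = N) :
    (lcpMachine c m v k).Reaches ω A B (enterWalk N n (search c m A B T ω n)) d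
      (d * (4 * m + 10)) (.locate (lowQuery (search c m A B T ω N))) := by
  induction d generalizing n with
  | zero =>
    obtain rfl : n = N := by omega
    rw [enterWalk, if_neg (lt_irrefl n), Nat.zero_mul]
    exact Machine.Reaches.refl _
  | succ d ih =>
    have h1 := ih (n + 1) (by omega)
    rw [Nat.succ_mul, add_comm d, add_comm (d * _)]
    refine Machine.Reaches.trans (reaches_of_next ?_ ?_ ?_) h1
    · rw [enterWalk, if_pos (by omega)]
      rfl
    · rw [enterWalk, if_pos (by omega)]
      simp only [aliceMessage, bobMessage, length_query, List.length_cons, List.length_nil,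
        List.length_append]
      omega
    · rw [enterWalk, if_pos (by omega)]
      simp only [aliceMessage, bobMessage, nextStage, List.getD_cons_zero, List.getD_cons_succ,
        search, test]
      rw [List.take_left' (length_query _ _ _), List.drop_left' (length_query _ _ _)]

/-- The number of exchanges by which the magnitude of the smaller of `L` and `M` is found. -/
def magnitudeRounds (v : Bool) (L M : ℕ) : ℕ := if v then level (min L M) + 1 else 1

/-- The number of bits by which the magnitude of the smaller of `L` and `M` is found. -/
def magnitudeBits (v : Bool) (L M : ℕ) : ℕ :=
  if v then (level (min L M) + 1) * 6 else 4 * (level L).size + 2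

/-- The loop stops as soon as one party finds its level to be at most `t`. By monotonicity of
`level` this is the level of the smaller length. -/
theorem reaches_double {p s : ℕ} {h : List Bool} (d t : ℕ)
    (hd : t + d = level (min (matchLength A p) (bobLength c m B p s h ω))) :
    (lcpMachine c m v k).Reaches ω A B (.double p s h t) (d + 1) ((d + 1) * 6)
      (.compare p s h (level (min (matchLength A p) (bobLength c m B p s h ω)))) := by
  rw [level_mono.map_min] at hd ⊢
  induction d generalizing t with
  | zero =>
    refine reaches_of_next rfl ?_ ?_
    · simp [aliceMessage, bobMessage]
    · simp only [aliceMessage, bobMessage, nextStage, List.getD_cons_zero]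
      rw [if_pos, ← hd]
      · rfl
      · rw [Bool.or_eq_true, decide_eq_true_eq, decide_eq_true_eq]
        omega
  | succ d ih =>
    have h1 := ih (t + 1) (by omega)
    rw [Nat.succ_mul (d + 1), add_comm (d + 1), add_comm ((d + 1) * _)]
    refine Machine.Reaches.trans (reaches_of_next rfl ?_ ?_) h1
    · simp [aliceMessage, bobMessage]
    · simp only [aliceMessage, bobMessage, nextStage, List.getD_cons_zero]
      rw [if_neg]
      rw [Bool.or_eq_true, decide_eq_true_eq, decide_eq_true_eq]
      omega

theorem reaches_estimate {p s : ℕ} {h : List Bool} :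
    (lcpMachine c m v k).Reaches ω A B (.estimate p s h) 1 (4 * (level (matchLength A p)).size + 2)
      (.compare p s h (level (min (matchLength A p) (bobLength c m B p s h ω)))) := by
  rw [level_mono.map_min]
  refine reaches_of_next rfl ?_ ?_
  · simp only [aliceMessage, bobMessage, ofBits_bits, Nat.size_eq_bits_len]
    have := Nat.size_le_size (min_le_left (level (matchLength A p))
      (level (bobLength c m B p s h ω)))
    omega
  · simp only [aliceMessage, bobMessage, nextStage, ofBits_bits]

/-- The cut-off `2 ^ 2 ^ t` exceeds the smaller length, so truncating both lengths keeps their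
minimum while each message has at most `2 ^ t + 1` bits. -/
theorem reaches_compare {p s : ℕ} {h : List Bool} :
    (lcpMachine c m v k).Reaches ω A B
      (.compare p s h (level (min (matchLength A p) (bobLength c m B p s h ω)))) 1
      (4 * 2 ^ level (min (matchLength A p) (bobLength c m B p s h ω)) + 6)
      (.done (p + min (matchLength A p) (bobLength c m B p s h ω))) := by
  set q := min (matchLength A p) (bobLength c m B p s h ω) with hq
  have h0 := lt_two_pow_level q
  refine reaches_of_next rfl ?_ ?_
  · simp only [aliceMessage, bobMessage, Nat.size_eq_bits_len]
    have h1 : ∀ a, (min a (2 ^ 2 ^ level q)).size ≤ 2 ^ level q + 1 := fun a => by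
      rw [← Nat.size_pow]
      exact Nat.size_le_size (min_le_right _ _)
    have h2 := h1 (matchLength A p)
    have h3 := h1 (bobLength c m B p s h ω)
    omega
  · simp only [aliceMessage, bobMessage, nextStage, ofBits_bits, Stage.done.injEq]
    omega

theorem reaches_locate {j p s M : ℕ} {h : List Bool} (hp : boundary A j = p) (hs : source A p = s)
    (hh : hash c m (2, 0) (A.take p) ω = h) (hM : bobLength c m B p s h ω = M) :
    (lcpMachine c m v k).Reaches ω A B (.locate j) (1 + (magnitudeRounds v (matchLength A p) M + 1))
      (2 * (m + (Nat.pair p s).size) + 2 + (magnitudeBits v (matchLength A p) M +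
        (4 * 2 ^ level (min (matchLength A p) M) + 6)))
      (.done (p + min (matchLength A p) M)) := by
  have h1 : (lcpMachine c m v k).Reaches ω A B (.locate j) 1
      (2 * (m + (Nat.pair p s).size) + 2)
      (if v then .double p s h 0 else .estimate p s h) := by
    refine reaches_of_next rfl ?_ ?_
    · simp only [aliceMessage, bobMessage, hp, hs, List.length_append, length_hash,
        Nat.size_eq_bits_len, List.length_nil]
      omega
    · simp only [aliceMessage, nextStage, hp, hs]
      rw [List.take_left' (length_hash _ _ _ _), List.drop_left' (length_hash _ _ _ _),
        ofBits_bits, Nat.unpair_pair, hh]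
      rfl
  subst hM
  refine h1.trans (Machine.Reaches.trans ?_ reaches_compare)
  cases v with
  | true => exact reaches_double _ 0 (zero_add _)
  | false => exact reaches_estimate

/-- The course of the protocol if the first test that fails is the one for `2 ^ T` phrases. -/
theorem reaches_done {T j p s M : ℕ} {h : List Bool}
    (hT : ∀ i < T, test c m A B (0, i) (2 ^ i) ω = true)
    (hT' : ¬ test c m A B (0, T) (2 ^ T) ω = true)
    (hj : lowQuery (search c m A B T ω (2 * T)) = j) (hp : boundary A j = p) (hs : source A p = s)
    (hh : hash c m (2, 0) (A.take p) ω = h) (hM : bobLength c m B p s h ω = M) :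
    (lcpMachine c m v k).Reaches ω A B (.gallop 0)
      (T + (1 + (2 * T + (1 + (magnitudeRounds v (matchLength A p) M + 1)))))
      (T * (2 * m + 6) + (2 * m + 6 + (2 * T * (4 * m + 10) + (2 * (m + (Nat.pair p s).size) + 2 +
        (magnitudeBits v (matchLength A p) M + (4 * 2 ^ level (min (matchLength A p) M) + 6))))))
      (.done (p + min (matchLength A p) M)) := by
  refine (reaches_gallop T hT).trans (Machine.Reaches.trans (s' := enterWalk (2 * T) 0 [2 ^ T, 0])
    (reaches_of_next rfl ?_ ?_) (Machine.Reaches.trans (reaches_walk (T := T) (2 * T) 0 (2 * T)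
      (zero_add _)) (hj ▸ reaches_locate hp hs hh hM)))
  · simp only [aliceMessage, bobMessage, length_query, List.length_cons, List.length_nil]
    omega
  · simp only [test] at hT'
    simp only [aliceMessage, bobMessage, nextStage, List.getD_cons_zero, hT']
    rfl

theorem halts_lcpMachine : ((lcpMachine c m v k).toProtocol.det ω).Halts A B := by
  classical
  have h : ∃ T, ¬ test c m A B (0, T) (2 ^ T) ω = true := by
    -- For `2 ^ A.length` phrases the boundary lies beyond the end of `A`, so Alice's leading bit
    -- makes the test fail for all coins.
    refine ⟨A.length, fun h => ?_⟩
    have h1 := ((test_eq_true_iff _ _ _).1 h).1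
    have h2 := le_boundary A (2 ^ A.length)
    have h3 := Nat.lt_two_pow_self (n := A.length)
    omega
  exact (reaches_done (v := v) (fun i hi => not_not.1 (Nat.find_min h hi)) (Nat.find_spec h)
    rfl rfl rfl rfl rfl).halts rfl

end Run

end

section

open ENNReal

variable {α : Type*} {k : ℕ}

/-! ### Success probability -/

section Success

variable {c : (ℕ × ℕ) × ℕ × List α → ℕ} {m : ℕ} {v : Bool} {A : List α} {B : Fin k → List α}

theorem two_pow_le_commonPhrases {i : ℕ} (h : i < (commonPhrases A B).size) :
    2 ^ i ≤ commonPhrases A B := Nat.lt_size.1 h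

open Classical in
/-- If there are no false positives in the tests outside the search and few in the search, then the
output is correct. -/
theorem computes_of_good (hk : 1 ≤ k) {ω : ℕ → Bool}
    (h1 : ¬ test c m A B (0, (commonPhrases A B).size) (2 ^ (commonPhrases A B).size) ω = true)
    (h2 : ¬ 2 * (commonPhrases A B).size < 4 * ((Finset.range (2 * (commonPhrases A B).size)).filter
      fun i => ω ∈ badStep c m A B i (search c m A B (commonPhrases A B).size ω i)).card)
    (h3 : ¬ ∃ i, (B i).take (boundary A (commonPhrases A B)) ≠
        A.take (boundary A (commonPhrases A B)) ∧
      hash c m (2, 0) ((B i).take (boundary A (commonPhrases A B))) ω =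
        hash c m (2, 0) (A.take (boundary A (commonPhrases A B))) ω)
    {r b : ℝ}
    (hrb : ∀ T p s L M : ℕ, T = (commonPhrases A B).size → p ≤ lcpMax A B → s ≤ p →
      min L M ≤ lcpMax A B → L ≤ A.length →
      ((2 * (T + (1 + (2 * T + (1 + (magnitudeRounds v L M + 1))))) : ℕ) : ℝ) ≤ r ∧
      ((T * (2 * m + 6) + (2 * m + 6 + (2 * T * (4 * m + 10) + (2 * (m + (Nat.pair p s).size) + 2 +
        (magnitudeBits v L M + (4 * 2 ^ level (min L M) + 6))))) : ℕ) : ℝ) ≤ b) :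
    ((lcpMachine c m v k).toProtocol.det ω).Computes A B (lcpMax A B) r b := by
  have hj := lowQuery_search hk (Nat.lt_size_self _) (not_lt.1 h2)
  set p := boundary A (commonPhrases A B) with hp
  have hout := add_min_bobLength hk hp h3
  have hpl : p ≤ lcpMax A B := (boundary_le_lcpMax_iff A B _).2 le_rfl
  have hs : source A p ≤ p := by
    rcases Nat.eq_zero_or_pos p with h0 | h0
    · simp [source, h0]
    · exact (source_lt A h0).le
  have hL := add_matchLength_le (hpl.trans (lcpMax_le_length A B))
  obtain ⟨hr, hb⟩ := hrb _ p (source A p) (matchLength A p) _ rfl hpl hs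
    (by omega : min (matchLength A p) (bobLength c m B p (source A p)
      (hash c m (2, 0) (A.take p) ω) ω) ≤ lcpMax A B) (by omega)
  exact Machine.Reaches.computes (M := lcpMachine c m v k)
    (reaches_done (v := v) (fun i hi => test_of_le hk _ (two_pow_le_commonPhrases hi) ω) h1 hj hp.symm
      rfl rfl rfl) (congrArg some hout) hr hb

/-- Only subadditivity is used, so the success event `X` need not be measurable. -/
theorem one_sub_le_coinMeasure {ε : ℝ} (hε : 0 ≤ ε) {X E : Set (ℕ → Bool)} (h : Eᶜ ⊆ X)
    (hE : coinMeasure E ≤ ENNReal.ofReal ε) : 1 - ε ≤ coinMeasure.real X := by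
  have h1 : (1 : ℝ) ≤ coinMeasure.real X + coinMeasure.real E := by
    calc (1 : ℝ) = coinMeasure.real Set.univ := by simp
      _ ≤ coinMeasure.real (X ∪ E) := measureReal_mono fun ω _ => by
          by_cases hω : ω ∈ E
          · exact Or.inr hω
          · exact Or.inl (h hω)
      _ ≤ _ := measureReal_union_le _ _
  have h2 : coinMeasure.real E ≤ ε := ENNReal.toReal_le_of_le_ofReal hε hE
  linarith

/-- With `δ = k * 2⁻¹ ^ m`, the factor `10` is `1 + 8 + 1`: the one galloping test that can mislead
costs `δ`, Markov's inequality for steps of error `2 * δ` costs `8 * δ`, and the final hash costs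
`δ`. -/
theorem solves_lcpMachine (hk : 1 ≤ k) (hc : Function.Injective c) {ε : ℝ} (hε : 0 ≤ ε)
    (hm : 10 * (k * (2⁻¹ : ℝ≥0∞) ^ m) ≤ ENNReal.ofReal ε)
    {r b : List α → (Fin k → List α) → ℝ}
    (hrb : ∀ A B, ∀ T p s L M : ℕ, T = (commonPhrases A B).size → p ≤ lcpMax A B → s ≤ p →
      min L M ≤ lcpMax A B → L ≤ A.length →
      ((2 * (T + (1 + (2 * T + (1 + (magnitudeRounds v L M + 1))))) : ℕ) : ℝ) ≤ r A B ∧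
      ((T * (2 * m + 6) + (2 * m + 6 + (2 * T * (4 * m + 10) + (2 * (m + (Nat.pair p s).size) + 2 +
        (magnitudeBits v L M + (4 * 2 ^ level (min L M) + 6))))) : ℕ) : ℝ) ≤ b A B) :
    ((lcpMachine c m v k).toProtocol).Solves ε lcpMax r b := by
  classical
  refine ⟨fun ω A B => halts_lcpMachine, fun A B => ?_⟩
  set T := (commonPhrases A B).size with hT
  have hE1 := coinMeasure_test_le (m := m) hk hc (0, T) (Nat.lt_size_self (commonPhrases A B))
  have hE2 := coinMeasure_count_le (2 * T)
    (fun n => {ω | ω ∈ badStep c m A B n (search c m A B T ω n)})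
    (fun n _ => measurableSet_badStep_search T n)
    (fun n _ => coinMeasure_badStep_search_le (m := m) hk hc T n)
  have hE3 := coinMeasure_exists_hash_eq_le (m := m) hc (2, 0)
    (A.take (boundary A (commonPhrases A B)))
    fun i => (B i).take (boundary A (commonPhrases A B))
  refine one_sub_le_coinMeasure hε (fun ω hω => ?_) (le_trans ((measure_union_le _ _).trans
    (add_le_add ((measure_union_le _ _).trans (add_le_add hE1 hE2)) hE3)) (le_trans (le_of_eq ?_) hm))
  · simp only [Set.compl_union, Set.mem_inter_iff, Set.mem_compl_iff, Set.mem_ofPred_eq] at hω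
    exact computes_of_good hk hω.1.1 hω.1.2 hω.2 (hrb A B)
  · ring

end Success

/-! ### The bounds -/

theorem one_le_lg (x : ℝ) : 1 ≤ lg x := le_max_left _ _

theorem lg_mono {x y : ℝ} (hx : 0 < x) (h : x ≤ y) : lg x ≤ lg y :=
  max_le_max le_rfl (Real.logb_le_logb_of_le one_lt_two hx h)

theorem lg_natCast_mono {a b : ℕ} (h : a ≤ b) : lg a ≤ lg b := by
  rcases Nat.eq_zero_or_pos a with rfl | ha
  · simp [lg]
  · exact lg_mono (by exact_mod_cast ha) (by exact_mod_cast h)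

theorem lg_two_mul_le {x : ℝ} (hx : 0 < x) : lg (2 * x) ≤ 2 * lg x := by
  have h1 := one_le_lg x
  have h2 : Real.logb 2 x ≤ lg x := le_max_right _ _
  refine max_le (by linarith) ?_
  rw [Real.logb_mul two_ne_zero hx.ne', Real.logb_self_eq_one one_lt_two]
  linarith

theorem size_le_two_mul_lg (n : ℕ) : (n.size : ℝ) ≤ 2 * lg n := by
  have h1 := one_le_lg n
  rcases Nat.eq_zero_or_pos n.size with h0 | h0
  · rw [h0, Nat.cast_zero]
    linarith
  · have h2 : 2 ^ (n.size - 1) ≤ n := Nat.lt_size.1 (by omega)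
    have h3 : ((n.size - 1 : ℕ) : ℝ) ≤ Real.logb 2 n := by
      rw [Real.le_logb_iff_rpow_le one_lt_two (by exact_mod_cast (Nat.size_pos.1 h0)),
        Real.rpow_natCast]
      exact_mod_cast h2
    have h4 : Real.logb 2 n ≤ lg n := le_max_right _ _
    rw [Nat.cast_sub h0, Nat.cast_one] at h3
    linarith

theorem level_le_four_mul_lg (n : ℕ) : (level n : ℝ) ≤ 4 * lg (lg n) := by
  have h1 := size_le_two_mul_lg n.size
  have h2 : lg n.size ≤ 2 * lg (lg n) := by
    rcases Nat.eq_zero_or_pos n.size with h0 | h0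
    · have := one_le_lg (lg n)
      simp only [h0, lg, Nat.cast_zero, Real.logb_zero] at this ⊢
      simp only [max_eq_left zero_le_one]
      linarith
    · exact (lg_mono (by exact_mod_cast h0) (size_le_two_mul_lg n)).trans
        (lg_two_mul_le (by linarith [one_le_lg n]))
  change ((n.size).size : ℝ) ≤ _
  linarith

theorem size_level_le (n : ℕ) : ((level n).size : ℝ) ≤ 8 * lg (lg (lg n)) := by
  have h1 := size_le_two_mul_lg (level n)
  have h3 := one_le_lg (lg n)
  have h2 : lg (level n) ≤ 4 * lg (lg (lg n)) := by
    rcases Nat.eq_zero_or_pos (level n) with h0 | h0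
    · have := one_le_lg (lg (lg n))
      simp only [h0, lg, Nat.cast_zero, Real.logb_zero] at this ⊢
      simp only [max_eq_left zero_le_one]
      linarith
    · have h4 : lg (level n) ≤ lg (2 * (2 * lg (lg n))) :=
        lg_mono (by exact_mod_cast h0) (by linarith [level_le_four_mul_lg n])
      have h5 := lg_two_mul_le (x := 2 * lg (lg n)) (by linarith)
      have h6 := lg_two_mul_le (x := lg (lg n)) (by linarith)
      linarith
  linarith

/-- Rounding the binary length up to a power of two at most doubles it, so the final exchange still
takes `O(lg ℓ)` bits. -/
theorem two_pow_level_le (n : ℕ) : (2 ^ level n : ℝ) ≤ 4 * lg n := by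
  have h1 := one_le_lg n
  have h2 := size_le_two_mul_lg n
  rcases Nat.eq_zero_or_pos (level n) with h0 | h0
  · rw [h0, pow_zero]
    linarith
  · have h3 : 2 ^ (level n - 1) ≤ n.size := Nat.lt_size.1 (by change level n - 1 < level n; omega)
    have h4 : ((2 ^ (level n - 1) : ℕ) : ℝ) ≤ n.size := by exact_mod_cast h3
    obtain ⟨d, hd⟩ : ∃ d, level n = d + 1 := ⟨level n - 1, by omega⟩
    rw [hd, Nat.add_sub_cancel] at h4
    rw [hd, pow_succ]
    push_cast at h4
    linarith

theorem size_pair_le {p s : ℕ} (h : s ≤ p) : (Nat.pair p s).size ≤ 2 * p.size := by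
  rw [Nat.size_le]
  calc Nat.pair p s < (max p s + 1) ^ 2 := Nat.pair_lt_max_add_one_sq p s
    _ ≤ (2 ^ p.size) ^ 2 := by
      rw [max_eq_left h]
      exact Nat.pow_le_pow_left (Nat.lt_size_self p) 2
    _ = 2 ^ (2 * p.size) := by rw [← pow_mul, mul_comm]

/-- Here `k.size` bits pay for the union bound over the `k` strings, and the constant `c₀` pays for
`ε`. -/
theorem exists_hash_length {ε : ℝ} (hε : 0 < ε) :
    ∃ c₀ : ℕ, ∀ k : ℕ, 10 * (k * (2⁻¹ : ℝ≥0∞) ^ (k.size + c₀)) ≤ ENNReal.ofReal ε := by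
  obtain ⟨c₀, h⟩ := exists_pow_lt_of_lt_one (show 0 < ε / 10 by linarith)
    (show (2⁻¹ : ℝ) < 1 by norm_num)
  refine ⟨c₀, fun k => ?_⟩
  have h1 : (10 * (k * (2⁻¹ : ℝ≥0∞) ^ (k.size + c₀))) =
      ENNReal.ofReal (10 * (k * (2⁻¹ : ℝ) ^ (k.size + c₀))) := by
    rw [ENNReal.ofReal_mul (by norm_num), ENNReal.ofReal_mul (by positivity),
      ENNReal.ofReal_pow (by norm_num), ENNReal.ofReal_natCast, ENNReal.ofReal_inv_of_pos two_pos]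
    norm_num
  rw [h1]
  apply ENNReal.ofReal_le_ofReal
  have h2 : (k : ℝ) * 2⁻¹ ^ k.size ≤ 1 := by
    rw [inv_pow, mul_inv_le_iff₀ (by positivity), one_mul]
    exact_mod_cast (Nat.lt_size_self k).le
  rw [pow_add, ← mul_assoc (k : ℝ)]
  have h3 : (k : ℝ) * 2⁻¹ ^ k.size * 2⁻¹ ^ c₀ ≤ 1 * (ε / 10) := by gcongr
  linarith

/-- The number of bits sent, where `w` of them serve to find the magnitude of the last copy. -/
theorem bits_le {T m c₀ k z p s q ℓ w : ℕ} {W : ℝ} (hm : m = k.size + c₀) (hT : T ≤ z.size)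
    (hp : p ≤ ℓ) (hs : s ≤ p) (hq : q ≤ ℓ) (hw : (w : ℝ) ≤ W) :
    ((T * (2 * m + 6) + (2 * m + 6 + (2 * T * (4 * m + 10) + (2 * (m + (Nat.pair p s).size) + 2 +
        (w + (4 * 2 ^ level q + 6))))) : ℕ) : ℝ) ≤
      (24 * c₀ + 120) * (lg z * lg k) + 38 * lg ℓ + W := by
  have hZ := one_le_lg z
  have hK := one_le_lg k
  have hl := one_le_lg ℓ
  have hT' : (T : ℝ) ≤ 2 * lg z :=
    (Nat.cast_le.2 hT).trans (size_le_two_mul_lg z)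
  have hm' : (m : ℝ) ≤ (c₀ + 2) * lg k := by
    have h1 := size_le_two_mul_lg k
    have h2 : (c₀ : ℝ) ≤ c₀ * lg k := le_mul_of_one_le_right (Nat.cast_nonneg _) hK
    rw [hm, Nat.cast_add]
    linarith
  have hpair : ((Nat.pair p s).size : ℝ) ≤ 4 * lg ℓ := by
    have h1 : ((Nat.pair p s).size : ℝ) ≤ 2 * p.size := by exact_mod_cast size_pair_le hs
    have h2 := size_le_two_mul_lg p
    have h3 := lg_natCast_mono hp
    linarith
  have hpow : (2 ^ level q : ℝ) ≤ 4 * lg ℓ :=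
    (two_pow_level_le q).trans (by linarith [lg_natCast_mono hq])
  have hTm : (T : ℝ) * m ≤ 2 * (c₀ + 2) * (lg z * lg k) := by
    calc (T : ℝ) * m ≤ (2 * lg z) * ((c₀ + 2) * lg k) := by gcongr
      _ = _ := by ring
  have hZK : lg z ≤ lg z * lg k := le_mul_of_one_le_right (by linarith) hK
  have hKZ : lg k ≤ lg z * lg k := le_mul_of_one_le_left (by linarith) hZ
  have hmZ : (m : ℝ) ≤ (c₀ + 2) * (lg z * lg k) := hm'.trans (by gcongr)
  push_cast
  nlinarith

end

end LZComm

end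

/-! ### The two protocols with their parameters -/

theorem theorem4 (ε : ℝ) (hε₀ : 0 < ε) (hε₁ : ε < 1 / 2) :
    (∃ C : ℝ, ∀ (α : Type*) [Finite α] (k : ℕ), 1 ≤ k →
      ∃ P : LZComm.PublicCoinProtocol (List α) (Fin k → List α) ℕ,
        P.Solves ε LZComm.lcpMax
          (fun A B =>
            let ℓ := LZComm.lcpMax A B
            let z := LZComm.numPhrases (A.take ℓ)
            C * (LZComm.lg z + LZComm.lg (LZComm.lg ℓ)))
          (fun A B =>
            let ℓ := LZComm.lcpMax A B
            let z := LZComm.numPhrases (A.take ℓ)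
            C * (LZComm.lg z * LZComm.lg k + LZComm.lg ℓ))) ∧
    (∃ C : ℝ, ∀ (α : Type*) [Finite α] (k : ℕ), 1 ≤ k →
      ∃ P : LZComm.PublicCoinProtocol (List α) (Fin k → List α) ℕ,
        P.Solves ε LZComm.lcpMax
          (fun A B =>
            let ℓ := LZComm.lcpMax A B
            let z := LZComm.numPhrases (A.take ℓ)
            C * LZComm.lg z)
          (fun A B =>
            let ℓ := LZComm.lcpMax A B
            let z := LZComm.numPhrases (A.take ℓ)
            C * (LZComm.lg z * LZComm.lg k + LZComm.lg ℓ +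
              LZComm.lg (LZComm.lg (LZComm.lg A.length))))) := by
  open LZComm in
  obtain ⟨c₀, hc₀⟩ := exists_hash_length hε₀
  have hc0 : (0 : ℝ) ≤ c₀ := Nat.cast_nonneg c₀
  have hT : ∀ {T z j : ℕ}, T = j.size → j ≤ z → (T : ℝ) ≤ 2 * lg z := by
    intro T z j hT hj
    refine le_trans ?_ (size_le_two_mul_lg z)
    rw [hT]
    exact_mod_cast Nat.size_le_size hj
  constructor
  · refine ⟨24 * c₀ + 120, fun α _ k hk => ?_⟩
    -- There are countably many strings, so every hash bit of every string can have its own coin.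
    obtain ⟨c, hc⟩ := exists_injective_nat ((ℕ × ℕ) × ℕ × List α)
    refine ⟨(lcpMachine c (k.size + c₀) true k).toProtocol,
      solves_lcpMachine hk hc hε₀.le (hc₀ k) ?_⟩
    intro A B T p s L M hTJ hp hs hq _
    have hJ := commonPhrases_le_numPhrases A B
    set ℓ := lcpMax A B with hℓ
    set z := numPhrases (A.take ℓ) with hz
    have hZ := one_le_lg z
    have hl := one_le_lg ℓ
    have hll := one_le_lg (lg ℓ)
    have hT1 := hT hTJ hJ
    have hlev1 : (level (min L M) : ℝ) ≤ 4 * lg (lg ℓ) :=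
      (Nat.cast_le.2 (level_mono hq)).trans (level_le_four_mul_lg ℓ)
    -- For the bit count the repeated squaring may be charged to `lg ℓ`, so this crude bound
    -- suffices.
    have hlev2 : (level (min L M) : ℝ) ≤ 4 * lg ℓ := by
      have h1 : (level (min L M) : ℝ) ≤ level ℓ := Nat.cast_le.2 (level_mono hq)
      have h2 : (level ℓ : ℝ) ≤ 2 ^ level ℓ := by exact_mod_cast Nat.lt_two_pow_self.le
      linarith [two_pow_level_le ℓ]
    have hlk := one_le_lg k
    constructor
    · simp only [magnitudeRounds, if_true]
      push_cast
      nlinarith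
    · refine (bits_le rfl (hTJ ▸ Nat.size_le_size hJ) hp hs hq
        (W := 30 * lg ℓ) ?_).trans ?_
      · simp only [magnitudeBits, if_true]
        push_cast
        linarith
      · simp only
        nlinarith
  · refine ⟨24 * c₀ + 120, fun α _ k hk => ?_⟩
    obtain ⟨c, hc⟩ := exists_injective_nat ((ℕ × ℕ) × ℕ × List α)
    refine ⟨(lcpMachine c (k.size + c₀) false k).toProtocol,
      solves_lcpMachine hk hc hε₀.le (hc₀ k) ?_⟩
    intro A B T p s L M hTJ hp hs hq hL
    have hJ := commonPhrases_le_numPhrases A B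
    set ℓ := lcpMax A B with hℓ
    set z := numPhrases (A.take ℓ) with hz
    have hZ := one_le_lg z
    have hl := one_le_lg ℓ
    have hA := one_le_lg (lg (lg A.length))
    have hT1 := hT hTJ hJ
    -- Alice's own copy may run far beyond `ℓ`, so the announced level is bounded only through the
    -- length of `A`.
    have hlev : ((level L).size : ℝ) ≤ 8 * lg (lg (lg A.length)) :=
      (Nat.cast_le.2 (Nat.size_le_size (level_mono hL))).trans (size_level_le _)
    constructor
    · simp only [magnitudeRounds, Bool.false_eq_true, if_false]
      push_cast
      nlinarith
    · refine (bits_le rfl (hTJ ▸ Nat.size_le_size hJ) hp hs hq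
        (W := 34 * lg (lg (lg A.length))) ?_).trans ?_
      · simp only [magnitudeBits, Bool.false_eq_true, if_false]
        push_cast
        linarith
      · simp only
        nlinarith
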